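/- Let $n\ge 3$ and let $b_1,\dots,b_n\in\mathbb R^d$ be distinct and not collinear. Let $\widetilde W\in\mathbb R^{n\times n}$ be a mixing matrix for a connected undirected graph on $\{1,\dots,n\}$, that is, $\widetilde w_{ij}=0$ whenever $i\ne j$ are not adjacent, $\widetilde W=\widetilde W^T$, and the null space of $I-\widetilde W$ is $\{c\mathbf 1: c\in\mathbb R\}$. Let $\mathbf A\in\mathbb R^{nd\times nd}$ be the matrix with $d\times d$ blocks $\mathbf W_{ij}=(1-\widetilde w_{ij})I_d$ if $i=j$ and $\mathbf W_{ij}=-\widetilde w_{ij}I_d$ if $i\neq j$, let $\mathbf A_{[i]}$ be its $i$-th column block, and let $\mathbf b=[b_1;\dots;b_n]\in\mathbb R^{nd}$. For $D>0$ put $\mathcal X=\{\mathbf x\in\mathbb R^{nd}:\|x_i-b_i\|\le D,\ i=1,\dots,n\}$ and $f(\mathbf x)=\sum_{i=1}^n\|x_i-b_i\|$, and consider the distributed geometric median problem $$\min f(\mathbf x)\quad\text{s.t.}\quad \mathbf A\mathbf x=0,\ \mathbf x\in\mathcal X ,$$ with optimal value $f^*$ and Lagrange dual function $F(\lambda)=\max_{\mathbf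 x\in\mathcal X}\{-\langle\lambda,\mathbf A\mathbf x\rangle-f(\mathbf x)\}$, $\lambda\in\mathbb R^{nd}$. Let $F^*=\inf F$ and $\Lambda^*=\{\lambda: F(\lambda)\le F(\lambda')\ \forall\lambda'\}$. (1) The maximum is attained, and $$F(\lambda)=-\langle \mathbf A^T\lambda,\mathbf b\rangle+D\sum_{i=1}^n(\|\mathbf A_{[i]}^T\lambda\|-1)\cdot I(\|\mathbf A_{[i]}^T\lambda\|>1)\quad\text{for all }\lambda .$$ $F$ is non-smooth: it is not differentiable at some $\lambda$. Suppose from now on that $D\ge 2n\max_{i,j}\|b_i-b_j\|$. (2) $F$ is convex, $\Lambda^*\neq\emptyset$, and for every $\delta>0$ there is $C_\delta>0$ such that $\operatorname{dist}(\lambda,\Lambda^*)\le C_\delta(F(\lambda)-F^*)^{1/2}$ for all $\lambda$ with $F(\lambda)-F^*\le\delta$. (3) Let $\mathcal P_{\mathbf A}$ be the orthogonal projection onto the column space of $\mathbf A$. There is exactly one $\nu^*\in\mathbb R^{nd}$ with $\mathcal P_{\mathbf A}\lambda^*=\nu^*$ for all $\lambda^*\in\Lambda^*$, and $\Lambda^*=\{\lambda:\mathcal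 P_{\mathbf A}\lambda=\nu^*\}$. (4) Let $R,M>0$ satisfy $\|\mathbf x-\mathbf y\|\le R$ and $|f(\mathbf x)|\le M$ for all $\mathbf x,\mathbf y\in\mathcal X$, let $\gamma>0$ satisfy $\gamma\,\sigma_{\max}(\mathbf A^T\mathbf A)\le1$, where $\sigma_{\max}$ denotes the largest eigenvalue, and let $\varepsilon_0\ge\max\{2M,1\}$. For $\mathbf x^{(0)}\in\mathcal X$ the homotopy method with $K$ stages of length $T$ sets $\lambda^{(0)}=0$, $\mu_0=\varepsilon_0/R^2$, and for $k=1,\dots,K$ it puts $\mu_k=\mu_{k-1}/2$ and runs, from $\lambda_0=\lambda_{-1}=\lambda^{(k-1)}$ and $\theta_0=\theta_{-1}=1$, for $t=0,\dots,T-1$, $$\widehat\lambda_t=\lambda_t+\theta_t(\theta_{t-1}^{-1}-1)(\lambda_t-\lambda_{t-1}),\qquad x(\widehat\lambda_t)=\operatorname*{argmax}_{\mathbf x\in\mathcal X}\ -\langle\widehat\lambda_t,\mathbf A\mathbf x\rangle-f(\mathbf x)-\tfrac{\mu_k}{2}\|\mathbf x-\mathbf x^{(k-1)}\|^2,$$ $$\lambda_{t+1}=\widehat\lambda_t+\gamma\mu_k\,\mathbf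 A\,x(\widehat\lambda_t),\qquad \theta_{t+1}=\tfrac12\bigl(\sqrt{\theta_t^4+4\theta_t^2}-\theta_t^2\bigr),$$ and then sets $\lambda^{(k)}=\lambda_T$ and $\mathbf x^{(k)}=\bigl(\sum_{t<T}\theta_t^{-1}\bigr)^{-1}\sum_{t<T}\theta_t^{-1}x(\widehat\lambda_t)$. There are constants $c,C>0$ such that for every $0<\varepsilon\le\frac12$ and every $\mathbf x^{(0)}\in\mathcal X$, with $K=\lceil\log_2(\varepsilon_0/\varepsilon)\rceil+1$: for every integer $T\ge c\,\varepsilon^{-4/5}$ the output satisfies $\mathbf x^{(K)}\in\mathcal X$, $f(\mathbf x^{(K)})-f^*\le C\varepsilon$ and $\|\mathbf A\mathbf x^{(K)}\|\le C\varepsilon$; and with $T=\lceil c\,\varepsilon^{-4/5}\rceil$ the method performs at most $C\varepsilon^{-4/5}\log_2(1/\varepsilon)$ primal maximization steps. That is, the convergence time is $O(\varepsilon^{-4/5}\log_2(\varepsilon^{-1}))$. -/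

import Mathlib

open Set

namespace DistMedian

noncomputable section

/-! ### Linearly constrained programs, their duals, and local error bounds -/

/-- The data of the problem `min f(x)` subject to `A x - b = 0`, `x ∈ X`. -/
structure Program (m k : Type) [Fintype m] [Fintype k] where
  /-- constraint matrix -/
  A : Matrix m k ℝ
  /-- right hand side -/
  b : EuclideanSpace ℝ m
  /-- objective -/
  f : EuclideanSpace ℝ k → ℝ
  /-- ground set -/
  X : Set (EuclideanSpace ℝ k)

namespace Program

variable {m k : Type} [Fintype m] [Fintype k] [DecidableEq k] (P : Program m k)

/-- The constraint residual `A x - b`. -/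
def residual (x : EuclideanSpace ℝ k) : EuclideanSpace ℝ m :=
  P.A.toEuclideanLin x - P.b

/-- The function `x ↦ -⟨lam, A x - b⟩ - f x`, maximized over `X` in the dual function. -/
def dualObjective (lam : EuclideanSpace ℝ m) (x : EuclideanSpace ℝ k) : ℝ :=
  -(inner ℝ lam (P.residual x)) - P.f x

/-- The Lagrange dual function `F(lam) = max_{x ∈ X} (-⟨lam, A x - b⟩ - f x)`. -/
def dual (lam : EuclideanSpace ℝ m) : ℝ :=
  sSup (P.dualObjective lam '' P.X)

/-- The optimal value of the primal problem. -/
def primalOpt : ℝ :=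
  sInf (P.f '' {x | x ∈ P.X ∧ P.residual x = 0})

/-- `x` is an `ε`-approximate solution with constant `C`. -/
def IsApproxSolution (C ε : ℝ) (x : EuclideanSpace ℝ k) : Prop :=
  x ∈ P.X ∧ P.f x - P.primalOpt ≤ C * ε ∧ ‖P.residual x‖ ≤ C * ε

/-- The orthogonal projection onto the column space of `A`. -/
def colProj (lam : EuclideanSpace ℝ m) : EuclideanSpace ℝ m :=
  (LinearMap.range P.A.toEuclideanLin).starProjection lam

/-- The largest eigenvalue of `Aᵀ A`. -/
def sigmaMax : ℝ := sSup (spectrum ℝ (P.A.transpose * P.A))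

end Program

section ErrorBound

variable {m : Type} [Fintype m]

/-- The minimum value `F^*` of a function on `ℝ^m`. -/
def minValue (F : EuclideanSpace ℝ m → ℝ) : ℝ := sInf (range F)

/-- The set of global minimizers of `F`. For a dual function: the optimal multipliers. -/
def minimizers (F : EuclideanSpace ℝ m → ℝ) : Set (EuclideanSpace ℝ m) :=
  {lam | ∀ lam', F lam ≤ F lam'}

/-- The `δ`-sublevel set of `F`. -/
def sublevel (F : EuclideanSpace ℝ m → ℝ) (δ : ℝ) : Set (EuclideanSpace ℝ m) :=
  {lam | F lam - minValue F ≤ δ}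

/-- The convex function `F` has a minimizer and satisfies the local error bound with parameter
`β ∈ (0, 1]` on its `δ`-sublevel set. -/
def LocalErrorBound (F : EuclideanSpace ℝ m → ℝ) (β δ : ℝ) : Prop :=
  0 < β ∧ β ≤ 1 ∧ ConvexOn ℝ univ F ∧ (minimizers F).Nonempty ∧
    ∃ C : ℝ, 0 < C ∧ ∀ lam ∈ sublevel F δ,
      Metric.infDist lam (minimizers F) ≤ C * (F lam - minValue F) ^ β

end ErrorBound

/-! ### The primal-dual homotopy smoothing method -/

namespace Program

variable {m k : Type} [Fintype m] [Fintype k] [DecidableEq k] (P : Program m k)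

/-- The function maximized over `X` in a primal update. -/
def smoothedObjective (μ : ℝ) (xt : EuclideanSpace ℝ k) (lam : EuclideanSpace ℝ m)
    (x : EuclideanSpace ℝ k) : ℝ :=
  P.dualObjective lam x - μ / 2 * ‖x - xt‖ ^ 2

/-- A primal update: `argmax_{x ∈ X} -⟨lam, A x - b⟩ - f x - (μ/2) ‖x - xt‖²`. -/
def primalUpdate (μ : ℝ) (xt : EuclideanSpace ℝ k) (lam : EuclideanSpace ℝ m) :
    EuclideanSpace ℝ k :=
  Classical.epsilon fun x => x ∈ P.X ∧ IsMaxOn (P.smoothedObjective μ xt lam) P.X x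

theorem primalUpdate_spec (hX : IsCompact P.X) (hne : P.X.Nonempty) (hf : Continuous P.f)
    (μ : ℝ) (xt : EuclideanSpace ℝ k) (lam : EuclideanSpace ℝ m) :
    P.primalUpdate μ xt lam ∈ P.X ∧
      IsMaxOn (P.smoothedObjective μ xt lam) P.X (P.primalUpdate μ xt lam) := by
  have hA : Continuous fun x => P.A.toEuclideanLin x :=
    LinearMap.continuous_of_finiteDimensional _
  have hc : Continuous (P.smoothedObjective μ xt lam) := by
    unfold smoothedObjective dualObjective residual
    fun_prop
  exact Classical.epsilon_spec (hX.exists_isMaxOn hne hc.continuousOn)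

/-- The state of the primal-dual smoothing loop before iteration `t`: the multipliers `lam_t` and
`lam_{t-1}`, the parameters `θ_t` and `θ_{t-1}`, the sums over `s < t` of `x(lamhat_s) / θ_s` and
of `1 / θ_s`, and the number of primal updates carried out. -/
structure LoopState (m k : Type) where
  lam : EuclideanSpace ℝ m
  lamPrev : EuclideanSpace ℝ m
  θ : ℝ
  θPrev : ℝ
  xSum : EuclideanSpace ℝ k
  S : ℝ
  steps : ℕ

/-- One iteration of the primal-dual smoothing loop with dual step size `γ μ`. -/
def loopStep (γ μ : ℝ) (xt : EuclideanSpace ℝ k) (s : LoopState m k) : LoopState m k :=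
  let lamHat := s.lam + (s.θ * (s.θPrev⁻¹ - 1)) • (s.lam - s.lamPrev)
  let x := P.primalUpdate μ xt lamHat
  { lam := lamHat + (γ * μ) • P.residual x
    lamPrev := s.lam
    θ := (Real.sqrt (s.θ ^ 4 + 4 * s.θ ^ 2) - s.θ ^ 2) / 2
    θPrev := s.θ
    xSum := s.xSum + s.θ⁻¹ • x
    S := s.S + s.θ⁻¹
    steps := s.steps + 1 }

/-- The state after `T` iterations of the loop, started at the multiplier `lam0`. -/
def loop (γ μ : ℝ) (lam0 : EuclideanSpace ℝ m) (xt : EuclideanSpace ℝ k) (T : ℕ) :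
    LoopState m k :=
  (P.loopStep γ μ xt)^[T]
    { lam := lam0, lamPrev := lam0, θ := 1, θPrev := 1, xSum := 0, S := 0, steps := 0 }

/-- The state of the homotopy method after a stage: multiplier, averaged primal point, smoothing
parameter, and the number of primal updates carried out so far. -/
structure StageState (m k : Type) where
  lam : EuclideanSpace ℝ m
  x : EuclideanSpace ℝ k
  μ : ℝ
  steps : ℕ

/-- One stage: halve `μ` and run `T` iterations of the primal-dual smoothing loop, restarted from
the last multiplier and the last averaged primal point. -/
def stage (γ : ℝ) (T : ℕ) (s : StageState m k) : StageState m k :=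
  let out := P.loop γ (s.μ / 2) s.lam s.x T
  { lam := out.lam
    x := out.S⁻¹ • out.xSum
    μ := s.μ / 2
    steps := s.steps + out.steps }

/-- The homotopy method: `K` stages of length `T`, started from the multiplier `0`, the point `x0`
and the smoothing parameter `μ₀ = ε0 / R²`. -/
def homotopy (γ R ε0 : ℝ) (x0 : EuclideanSpace ℝ k) (T K : ℕ) : StageState m k :=
  (P.stage γ T)^[K] { lam := 0, x := x0, μ := ε0 / R ^ 2, steps := 0 }

end Program

/-! ### The distributed geometric median problem -/

/-- `W` is a mixing matrix for the network `G`. -/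
structure IsMixingMatrix {n : ℕ} (G : SimpleGraph (Fin n)) (W : Matrix (Fin n) (Fin n) ℝ) :
    Prop where
  decentralized : ∀ i j, i ≠ j → ¬ G.Adj i j → W i j = 0
  symm : W.transpose = W
  nullSpace : ∀ v : Fin n → ℝ, (1 - W).mulVec v = 0 ↔ ∃ c : ℝ, v = fun _ => c

variable {n d : ℕ}

/-- The block `x_i ∈ ℝ^d` of `x ∈ ℝ^{nd}`. -/
def block (x : EuclideanSpace ℝ (Fin n × Fin d)) (i : Fin n) : EuclideanSpace ℝ (Fin d) :=
  WithLp.toLp 2 fun l => x (i, l)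

/-- The stacked vector `[v_1; …; v_n] ∈ ℝ^{nd}`. -/
def stack (v : Fin n → EuclideanSpace ℝ (Fin d)) : EuclideanSpace ℝ (Fin n × Fin d) :=
  WithLp.toLp 2 fun r => v r.1 r.2

/-- The `d × d` block `W_{ij}` of the constraint matrix. -/
def blockW (W : Matrix (Fin n) (Fin n) ℝ) (i j : Fin n) : Matrix (Fin d) (Fin d) ℝ :=
  if i = j then (1 - W i j) • 1 else (-W i j) • 1

/-- The `nd × nd` constraint matrix with blocks `W_{ij}`. -/
def consMatrix (d : ℕ) (W : Matrix (Fin n) (Fin n) ℝ) :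
    Matrix (Fin n × Fin d) (Fin n × Fin d) ℝ :=
  Matrix.of fun r c => blockW W r.1 c.1 r.2 c.2

/-- The `i`-th column block of a matrix with `nd` columns. -/
def colBlock (A : Matrix (Fin n × Fin d) (Fin n × Fin d) ℝ) (i : Fin n) :
    Matrix (Fin n × Fin d) (Fin d) ℝ :=
  A.submatrix id fun l => (i, l)

/-- The problem `min ∑ᵢ ‖x_i - p_i‖` subject to `A x = 0` and `‖x_i - p_i‖ ≤ D` for all `i`. -/
def medianProgram (p : Fin n → EuclideanSpace ℝ (Fin d)) (W : Matrix (Fin n) (Fin n) ℝ) (D : ℝ) :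
    Program (Fin n × Fin d) (Fin n × Fin d) where
  A := consMatrix d W
  b := 0
  f := fun x => ∑ i, ‖block x i - p i‖
  X := {x | ∀ i, ‖block x i - p i‖ ≤ D}

end

end DistMedian

open DistMedian

/-!
Write `F` for the dual function, `y = A lam` for the image of a multiplier under the (symmetric)
constraint matrix, and `u i = z - p i` for a geometric median `z` of the points.

**The dual of the median problem.** The Lagrangian separates over the blocks and each block is
maximized over its ball, which gives the formula for `F` (`dual_medianProgram`); along a suitable
ray the positive parts in it produce a kink (`exists_not_differentiableAt_dual`). First-order
optimality of `z` yields vectors `y* i` of norm at most `1` with sum zero and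
`⟨y* i, u i⟩ = -‖u i‖` (`exists_medianCertificate`). The column space of `A` consists of the vectors
whose blocks sum to zero, so `y*` is the image of a multiplier, and the dual gap at `lam` is
`∑ i, (⟨y i, u i⟩ + ‖u i‖ + D (‖y i‖ - 1)⁺)`, a sum of nonnegative terms. Since `‖u i‖ ≤ D / 2`,
the `i`-th term dominates `‖y i - y* i‖²` on sublevel sets as soon as `u i ≠ 0`
(`norm_sub_sq_le_blockGap`). At most one `u i` vanishes because the points are distinct, and that
block is controlled by the others since all blocks sum to zero. As `A` is bounded below on its column
space, the gap dominates the squared distance of the projection of `lam` to a fixed `ν`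
(`exists_quadraticDualGrowth`); this contains the error bound with exponent `1/2` and the
description of the minimizers.

**The homotopy method**, for any convex program with such quadratic dual growth. The smoothed dual
has a `1 / (γ μ)`-Lipschitz gradient (`smoothedDual_le`), and the loop is the accelerated gradient
method on it, with the primal-dual guarantee `loop_primal_dual_le` against every comparison
multiplier. Its total weight `S` after `T` steps is at least `T² / 4`. Comparing with the nearest
dual minimizer, a dual gap of order `E = μ R²` is halved in each stage. The residual of the averaged
point is `(z_T - lam_0) / (γ μ S)` exactly (here `z_T` is the auxiliary sequence of the method), and
`z_T` is no further than `lam_0` from a minimizer of the smoothed dual, which quadratic growth places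
at distance `O(√E)`; so the residual is `O(√E / (E T²))`, and with `T` of order `ε ^ (-4/5)` it is
`O(ε)` when `E` is of order `ε`. The objective gap then follows from the residual bound.
-/

namespace DistMedian

/-! ### Convex programs and their smoothed duals -/

namespace Program

section Convexity

variable {m k : Type} [Fintype m] [Fintype k]

/-- A program with a nonempty compact convex ground set and a continuous convex objective. -/
structure IsConvexProgram (P : Program m k) : Prop where
  compact : IsCompact P.X
  nonempty : P.X.Nonempty
  continuous : Continuous P.f
  convex : ConvexOn ℝ P.X P.f

/-- The objective with the proximal term added. -/
noncomputable def proxObjective (P : Program m k) (μ : ℝ) (xt x : EuclideanSpace ℝ k) : ℝ :=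
  P.f x + μ / 2 * ‖x - xt‖ ^ 2

theorem IsConvexProgram.convexOn_proxObjective {P : Program m k} (hP : P.IsConvexProgram)
    {μ : ℝ} (hμ : 0 ≤ μ) (xt : EuclideanSpace ℝ k) : ConvexOn ℝ P.X (P.proxObjective μ xt) := by
  have h1 : ConvexOn ℝ univ fun x : EuclideanSpace ℝ k => ‖x - xt‖ := by
    simpa [dist_eq_norm] using convexOn_univ_dist xt
  have h2 : ConvexOn ℝ univ fun x : EuclideanSpace ℝ k => ‖x - xt‖ ^ 2 :=
    h1.pow (fun x _ => norm_nonneg _) 2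
  have h3 := (h2.smul (show 0 ≤ μ / 2 by positivity)).subset (subset_univ P.X) hP.convex.1
  exact hP.convex.add h3

end Convexity

variable {m k : Type} [Fintype m] [Fintype k] [DecidableEq k]

/-- The smoothed dual function, the maximum over `X` of
`-⟨lam, A x - b⟩ - f x - (μ/2) ‖x - xt‖²`. -/
noncomputable def smoothedDual (P : Program m k) (μ : ℝ) (xt : EuclideanSpace ℝ k)
    (lam : EuclideanSpace ℝ m) : ℝ :=
  P.smoothedObjective μ xt lam (P.primalUpdate μ xt lam)

variable {P : Program m k}

theorem smoothedObjective_eq (μ : ℝ) (xt : EuclideanSpace ℝ k) (lam : EuclideanSpace ℝ m)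
    (x : EuclideanSpace ℝ k) :
    P.smoothedObjective μ xt lam x = -(inner ℝ lam (P.residual x)) - P.proxObjective μ xt x := by
  simp only [smoothedObjective, dualObjective, proxObjective]; ring

theorem residual_sub (x y : EuclideanSpace ℝ k) :
    P.residual x - P.residual y = P.A.toEuclideanLin (x - y) := by
  simp [residual]

namespace IsConvexProgram

theorem primalUpdate_mem (hP : P.IsConvexProgram) (μ : ℝ) (xt : EuclideanSpace ℝ k)
    (lam : EuclideanSpace ℝ m) : P.primalUpdate μ xt lam ∈ P.X :=
  (P.primalUpdate_spec hP.compact hP.nonempty hP.continuous μ xt lam).1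

theorem smoothedObjective_le (hP : P.IsConvexProgram) (μ : ℝ) (xt : EuclideanSpace ℝ k)
    (lam : EuclideanSpace ℝ m) {x : EuclideanSpace ℝ k} (hx : x ∈ P.X) :
    P.smoothedObjective μ xt lam x ≤ P.smoothedDual μ xt lam :=
  (P.primalUpdate_spec hP.compact hP.nonempty hP.continuous μ xt lam).2 hx

theorem isGreatest_dual (hP : P.IsConvexProgram) (lam : EuclideanSpace ℝ m) :
    IsGreatest (P.dualObjective lam '' P.X) (P.dual lam) := by
  have hA : Continuous fun x => P.A.toEuclideanLin x :=
    LinearMap.continuous_of_finiteDimensional _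
  have hf := hP.continuous
  have hc : Continuous (P.dualObjective lam) := by
    unfold dualObjective residual
    fun_prop
  exact (hP.compact.image hc).isGreatest_sSup (hP.nonempty.image _)

theorem dualObjective_le (hP : P.IsConvexProgram) (lam : EuclideanSpace ℝ m)
    {x : EuclideanSpace ℝ k} (hx : x ∈ P.X) : P.dualObjective lam x ≤ P.dual lam :=
  (hP.isGreatest_dual lam).2 ⟨x, hx, rfl⟩

theorem convexOn_dual (hP : P.IsConvexProgram) : ConvexOn ℝ univ P.dual := by
  refine ⟨convex_univ, fun u _ v _ a b ha hb hab => ?_⟩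
  obtain ⟨x, hx, he⟩ := (hP.isGreatest_dual (a • u + b • v)).1
  have h1 := mul_le_mul_of_nonneg_left (hP.dualObjective_le u hx) ha
  have h2 := mul_le_mul_of_nonneg_left (hP.dualObjective_le v hx) hb
  rw [← he]
  simp only [dualObjective, inner_add_left, inner_smul_left, smul_eq_mul, conj_trivial] at *
  have : P.f x = a * P.f x + b * P.f x := by rw [← add_mul, hab, one_mul]
  linarith

theorem smoothedDual_le_dual (hP : P.IsConvexProgram) {μ : ℝ} (hμ : 0 ≤ μ)
    (xt : EuclideanSpace ℝ k) (lam : EuclideanSpace ℝ m) :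
    P.smoothedDual μ xt lam ≤ P.dual lam := by
  have h := hP.dualObjective_le lam (hP.primalUpdate_mem μ xt lam)
  have : 0 ≤ μ / 2 * ‖P.primalUpdate μ xt lam - xt‖ ^ 2 := by positivity
  simp only [smoothedDual, smoothedObjective]
  linarith

theorem dual_le_smoothedDual (hP : P.IsConvexProgram) {μ R : ℝ} (hμ : 0 ≤ μ)
    {xt : EuclideanSpace ℝ k} (hR : ∀ x ∈ P.X, ‖x - xt‖ ≤ R) (lam : EuclideanSpace ℝ m) :
    P.dual lam ≤ P.smoothedDual μ xt lam + μ / 2 * R ^ 2 := by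
  obtain ⟨x, hx, he⟩ := (hP.isGreatest_dual lam).1
  have h := hP.smoothedObjective_le μ xt lam hx
  have h2 : μ / 2 * ‖x - xt‖ ^ 2 ≤ μ / 2 * R ^ 2 := by
    have := hR x hx
    gcongr
  rw [← he]
  simp only [smoothedObjective] at h
  linarith

/-- Weak duality. -/
theorem primalOpt_ge (hP : P.IsConvexProgram) (hfeas : ∃ x ∈ P.X, P.residual x = 0)
    (lam : EuclideanSpace ℝ m) : -P.dual lam ≤ P.primalOpt := by
  obtain ⟨x₀, hx₀, hr₀⟩ := hfeas
  refine le_csInf ⟨_, x₀, ⟨hx₀, hr₀⟩, rfl⟩ ?_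
  rintro _ ⟨x, ⟨hx, hr⟩, rfl⟩
  have := hP.dualObjective_le lam hx
  simp only [dualObjective, hr, inner_zero_right] at this
  linarith

/-- The maximizer of the `μ`-strongly concave smoothed objective is optimal with a quadratic
margin. -/
theorem smoothedObjective_add_le (hP : P.IsConvexProgram) (μ : ℝ)
    (xt : EuclideanSpace ℝ k) (lam : EuclideanSpace ℝ m) {x : EuclideanSpace ℝ k} (hx : x ∈ P.X) :
    P.smoothedObjective μ xt lam x + μ / 2 * ‖x - P.primalUpdate μ xt lam‖ ^ 2 ≤
      P.smoothedDual μ xt lam := by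
  set y := P.primalUpdate μ xt lam with hy
  have hyX : y ∈ P.X := hP.primalUpdate_mem μ xt lam
  have key : ∀ t ∈ Ioo (0 : ℝ) 1,
      P.smoothedObjective μ xt lam x + μ / 2 * ‖x - y‖ ^ 2 * (1 - t) ≤
        P.smoothedDual μ xt lam := by
    rintro t ⟨ht0, ht1⟩
    have hmem : (1 - t) • y + t • x ∈ P.X :=
      hP.convex.1 hyX hx (by linarith) ht0.le (by ring)
    have hf := hP.convex.2 hyX hx (show 0 ≤ 1 - t by linarith) ht0.le (by ring)
    have hle := hP.smoothedObjective_le μ xt lam hmem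
    have hd : P.smoothedDual μ xt lam = P.smoothedObjective μ xt lam y := rfl
    have hn : ‖(1 - t) • y + t • x - xt‖ ^ 2 =
        (1 - t) * ‖y - xt‖ ^ 2 + t * ‖x - xt‖ ^ 2 - t * (1 - t) * ‖x - y‖ ^ 2 := by
      have e1 : (1 - t) • y + t • x - xt = (1 - t) • (y - xt) + t • (x - xt) := by module
      have e2 : x - y = (x - xt) - (y - xt) := by module
      rw [e1, e2]
      generalize y - xt = u
      generalize x - xt = v
      rw [norm_add_sq_real, norm_sub_sq_real, norm_smul, norm_smul, inner_smul_left,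
        inner_smul_right, mul_pow, mul_pow, Real.norm_eq_abs, Real.norm_eq_abs, sq_abs, sq_abs,
        real_inner_comm u]
      simp only [conj_trivial]
      ring
    have hr : P.residual ((1 - t) • y + t • x) =
        (1 - t) • P.residual y + t • P.residual x := by
      simp only [residual, map_add, map_smul]; module
    rw [hd] at hle ⊢
    simp only [smoothedObjective, dualObjective] at *
    rw [hn, hr, inner_add_right, inner_smul_right, inner_smul_right] at hle
    simp only [smul_eq_mul] at hf
    have : 0 ≤ t * ((-(inner ℝ lam (P.residual y)) - P.f y - μ / 2 * ‖y - xt‖ ^ 2) -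
        (-(inner ℝ lam (P.residual x)) - P.f x - μ / 2 * ‖x - xt‖ ^ 2 +
          μ / 2 * ‖x - y‖ ^ 2 * (1 - t))) := by
      nlinarith
    have := nonneg_of_mul_nonneg_right this ht0
    linarith
  have hlim : Filter.Tendsto
      (fun t : ℝ => P.smoothedObjective μ xt lam x + μ / 2 * ‖x - y‖ ^ 2 * (1 - t))
      (nhdsWithin 0 (Ioi 0))
      (nhds (P.smoothedObjective μ xt lam x + μ / 2 * ‖x - y‖ ^ 2 * (1 - 0))) :=
    (Continuous.tendsto (by fun_prop) 0).mono_left nhdsWithin_le_nhds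
  have := le_of_tendsto hlim (Filter.mem_of_superset (Ioo_mem_nhdsGT zero_lt_one) key)
  simpa using this

/-- The smoothed dual has gradient `-(A x_lam - b)`, which is Lipschitz with constant
`‖A‖² / μ ≤ 1 / (γ μ)`; this is the resulting quadratic upper bound. -/
theorem smoothedDual_le (hP : P.IsConvexProgram) {γ μ : ℝ} (hγ : 0 < γ) (hμ : 0 < μ)
    (hA : ∀ v, γ * ‖P.A.toEuclideanLin v‖ ^ 2 ≤ ‖v‖ ^ 2)
    (xt : EuclideanSpace ℝ k) (lam lam' : EuclideanSpace ℝ m) :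
    P.smoothedDual μ xt lam' ≤ P.smoothedDual μ xt lam -
      inner ℝ (lam' - lam) (P.residual (P.primalUpdate μ xt lam)) +
      ‖lam' - lam‖ ^ 2 / (2 * (γ * μ)) := by
  set x := P.primalUpdate μ xt lam
  set x' := P.primalUpdate μ xt lam' with hx'
  have h1 := hP.smoothedObjective_add_le μ xt lam (hP.primalUpdate_mem μ xt lam')
  rw [← hx'] at h1
  have h2 : P.smoothedDual μ xt lam' = P.smoothedObjective μ xt lam x' -
      inner ℝ (lam' - lam) (P.residual x) -
      inner ℝ (lam' - lam) (P.A.toEuclideanLin (x' - x)) := by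
    rw [← residual_sub, smoothedDual, ← hx']
    simp only [smoothedObjective_eq, inner_sub_left, inner_sub_right]
    ring
  have h3 : -(inner ℝ (lam' - lam) (P.A.toEuclideanLin (x' - x))) ≤
      ‖lam' - lam‖ ^ 2 / (2 * (γ * μ)) + μ / 2 * ‖x' - x‖ ^ 2 := by
    have hc := abs_real_inner_le_norm (lam' - lam) (P.A.toEuclideanLin (x' - x))
    have hc' := neg_le_of_abs_le hc
    have ha := hA (x' - x)
    set a := ‖lam' - lam‖
    set c := ‖P.A.toEuclideanLin (x' - x)‖
    have e : a * c ≤ a ^ 2 / (2 * (γ * μ)) + γ * μ / 2 * c ^ 2 := by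
      have : a ^ 2 / (2 * (γ * μ)) + γ * μ / 2 * c ^ 2 - a * c =
          (a - γ * μ * c) ^ 2 / (2 * (γ * μ)) := by field_simp; ring
      have : 0 ≤ (a - γ * μ * c) ^ 2 / (2 * (γ * μ)) := by positivity
      linarith
    have : μ / 2 * (γ * c ^ 2) ≤ μ / 2 * ‖x' - x‖ ^ 2 := by gcongr
    linarith
  linarith

end IsConvexProgram

/-! ### The accelerated loop -/

/-- The update of `θ` is the positive root of `τ² + θ² τ = θ²`, so that `τ⁻² - τ⁻¹ = θ⁻²`. -/
theorem theta_step {θ : ℝ} (h0 : 0 < θ) :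
    0 < (Real.sqrt (θ ^ 4 + 4 * θ ^ 2) - θ ^ 2) / 2 ∧
      (Real.sqrt (θ ^ 4 + 4 * θ ^ 2) - θ ^ 2) / 2 ≤ 1 ∧
      ((Real.sqrt (θ ^ 4 + 4 * θ ^ 2) - θ ^ 2) / 2)⁻¹ ^ 2 -
        ((Real.sqrt (θ ^ 4 + 4 * θ ^ 2) - θ ^ 2) / 2)⁻¹ = θ⁻¹ ^ 2 ∧
      θ⁻¹ + 1 / 2 ≤ ((Real.sqrt (θ ^ 4 + 4 * θ ^ 2) - θ ^ 2) / 2)⁻¹ := by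
  set q := Real.sqrt (θ ^ 4 + 4 * θ ^ 2) with hq
  have hq2 : q ^ 2 = θ ^ 4 + 4 * θ ^ 2 := Real.sq_sqrt (by positivity)
  have hq0 : 0 ≤ q := Real.sqrt_nonneg _
  have hpos : 0 < (q - θ ^ 2) / 2 := by
    have : θ ^ 2 < q := by
      apply lt_of_pow_lt_pow_left₀ 2 hq0
      rw [hq2]
      nlinarith [pow_pos h0 2]
    linarith
  set τ := (q - θ ^ 2) / 2 with hτ
  have hroot : τ ^ 2 + θ ^ 2 * τ = θ ^ 2 := by
    rw [hτ]; nlinarith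
  have hle : τ ≤ 1 := by nlinarith [pow_pos h0 2]
  have hinv : τ⁻¹ ^ 2 - τ⁻¹ = θ⁻¹ ^ 2 := by
    field_simp
    linarith
  refine ⟨hpos, hle, hinv, ?_⟩
  have ha : 1 ≤ τ⁻¹ := (one_le_inv₀ hpos).2 hle
  have hb : 0 < θ⁻¹ := inv_pos.2 h0
  nlinarith

/-- The extrapolated multiplier of a loop state, at which the next primal update takes place. -/
noncomputable def LoopState.lamHat (s : LoopState m k) : EuclideanSpace ℝ m :=
  s.lam + (s.θ * (s.θPrev⁻¹ - 1)) • (s.lam - s.lamPrev)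

/-- The auxiliary sequence of the accelerated method, `z = lam₋ + θ₋⁻¹ (lam - lam₋)`. The
extrapolated multiplier is the convex combination `(1 - θ) lam + θ z`. -/
noncomputable def LoopState.z (s : LoopState m k) : EuclideanSpace ℝ m :=
  s.lamPrev + s.θPrev⁻¹ • (s.lam - s.lamPrev)

/-- The primal update in iteration `t` of the loop. -/
noncomputable def loopPoint (P : Program m k) (γ μ : ℝ) (lam0 : EuclideanSpace ℝ m)
    (xt : EuclideanSpace ℝ k) (t : ℕ) : EuclideanSpace ℝ k :=
  P.primalUpdate μ xt (P.loop γ μ lam0 xt t).lamHat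

theorem loop_succ (γ μ : ℝ) (lam0 : EuclideanSpace ℝ m) (xt : EuclideanSpace ℝ k) (t : ℕ) :
    P.loop γ μ lam0 xt (t + 1) = P.loopStep γ μ xt (P.loop γ μ lam0 xt t) := by
  simp only [loop, Function.iterate_succ_apply']

theorem loop_steps (γ μ : ℝ) (lam0 : EuclideanSpace ℝ m) (xt : EuclideanSpace ℝ k) (t : ℕ) :
    (P.loop γ μ lam0 xt t).steps = t := by
  induction t with
  | zero => rfl
  | succ t ih => rw [loop_succ]; simp [loopStep, ih]

/-- The invariant `S = θ⁻² - θ⁻¹` makes the weights of the accelerated method telescope, and the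
linear growth of `θ⁻¹` makes `S` grow quadratically. -/
theorem loop_theta (γ μ : ℝ) (lam0 : EuclideanSpace ℝ m) (xt : EuclideanSpace ℝ k) (t : ℕ) :
    0 < (P.loop γ μ lam0 xt t).θ ∧ (P.loop γ μ lam0 xt t).θ ≤ 1 ∧
      0 < (P.loop γ μ lam0 xt t).θPrev ∧
      (P.loop γ μ lam0 xt t).S =
        (P.loop γ μ lam0 xt t).θ⁻¹ ^ 2 - (P.loop γ μ lam0 xt t).θ⁻¹ ∧
      1 + (t : ℝ) / 2 ≤ (P.loop γ μ lam0 xt t).θ⁻¹ := by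
  induction t with
  | zero => simp [loop]
  | succ t ih =>
    obtain ⟨h0, -, -, hS, ht⟩ := ih
    obtain ⟨g0, g1, gS, gt⟩ := theta_step h0
    rw [loop_succ]
    refine ⟨g0, g1, h0, ?_, ?_⟩
    · simp only [loopStep]
      rw [gS, hS]; ring
    · simp only [loopStep]
      push_cast
      linarith

theorem le_loop_S (γ μ : ℝ) (lam0 : EuclideanSpace ℝ m) (xt : EuclideanSpace ℝ k) (t : ℕ) :
    (t : ℝ) ^ 2 / 4 ≤ (P.loop γ μ lam0 xt t).S := by
  obtain ⟨-, -, -, hS, ht⟩ := loop_theta (P := P) γ μ lam0 xt t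
  rw [hS]
  have : (0 : ℝ) ≤ t := Nat.cast_nonneg t
  nlinarith

theorem loop_sums (γ μ : ℝ) (lam0 : EuclideanSpace ℝ m) (xt : EuclideanSpace ℝ k) (t : ℕ) :
    (P.loop γ μ lam0 xt t).xSum =
        ∑ s ∈ Finset.range t, (P.loop γ μ lam0 xt s).θ⁻¹ • P.loopPoint γ μ lam0 xt s ∧
      (P.loop γ μ lam0 xt t).S = ∑ s ∈ Finset.range t, (P.loop γ μ lam0 xt s).θ⁻¹ := by
  induction t with
  | zero => simp [loop]
  | succ t ih =>
    rw [Finset.sum_range_succ, Finset.sum_range_succ, ← ih.1, ← ih.2, loop_succ]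
    exact ⟨rfl, rfl⟩

theorem loop_z (γ μ : ℝ) (lam0 : EuclideanSpace ℝ m) (xt : EuclideanSpace ℝ k) (t : ℕ) :
    (P.loop γ μ lam0 xt (t + 1)).z = (P.loop γ μ lam0 xt t).z +
      (γ * μ * (P.loop γ μ lam0 xt t).θ⁻¹) • P.residual (P.loopPoint γ μ lam0 xt t) := by
  have h0 := (loop_theta (P := P) γ μ lam0 xt t).1.ne'
  have hx : P.loopPoint γ μ lam0 xt t = P.primalUpdate μ xt (P.loop γ μ lam0 xt t).lamHat := rfl
  rw [loop_succ]
  rw [hx]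
  generalize P.loop γ μ lam0 xt t = s at *
  have e : (P.loopStep γ μ xt s).z = s.lam + s.θ⁻¹ •
      (s.lamHat + (γ * μ) • P.residual (P.primalUpdate μ xt s.lamHat) - s.lam) := rfl
  rw [e]
  generalize P.residual (P.primalUpdate μ xt s.lamHat) = r
  simp only [LoopState.lamHat, LoopState.z]
  match_scalars <;> field_simp <;> ring

theorem loop_z_eq (γ μ : ℝ) (lam0 : EuclideanSpace ℝ m) (xt : EuclideanSpace ℝ k) (t : ℕ) :
    (P.loop γ μ lam0 xt t).z = lam0 + (γ * μ) • ∑ s ∈ Finset.range t,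
      (P.loop γ μ lam0 xt s).θ⁻¹ • P.residual (P.loopPoint γ μ lam0 xt s) := by
  induction t with
  | zero => simp [loop, LoopState.z]
  | succ t ih => rw [loop_z, ih, Finset.sum_range_succ]; module

namespace IsConvexProgram

/-- One accelerated step: a contraction by the factor `1 - θ` towards the linearized dual at an
arbitrary comparison multiplier `lam`, up to a telescoping difference of squared distances. -/
theorem smoothedDual_loopStep_le (hP : P.IsConvexProgram) {γ μ : ℝ} (hγ : 0 < γ) (hμ : 0 < μ)
    (hA : ∀ v, γ * ‖P.A.toEuclideanLin v‖ ^ 2 ≤ ‖v‖ ^ 2) (xt : EuclideanSpace ℝ k)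
    (s : LoopState m k) (h0 : 0 < s.θ) (h1 : s.θ ≤ 1) (lam : EuclideanSpace ℝ m) :
    P.smoothedDual μ xt (P.loopStep γ μ xt s).lam ≤
      (1 - s.θ) * P.smoothedDual μ xt s.lam +
      s.θ * P.smoothedObjective μ xt lam (P.primalUpdate μ xt s.lamHat) +
      s.θ ^ 2 / (2 * (γ * μ)) * (‖lam - s.z‖ ^ 2 - ‖lam - (s.z + (γ * μ * s.θ⁻¹) •
        P.residual (P.primalUpdate μ xt s.lamHat))‖ ^ 2) := by
  set x := P.primalUpdate μ xt s.lamHat with hx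
  have hη : 0 < γ * μ := mul_pos hγ hμ
  have hstep : (P.loopStep γ μ xt s).lam = s.lamHat + (γ * μ) • P.residual x := rfl
  have hdesc := hP.smoothedDual_le hγ hμ hA xt s.lamHat (P.loopStep γ μ xt s).lam
  rw [← hx, hstep, add_sub_cancel_left, inner_smul_left, real_inner_self_eq_norm_sq,
    norm_smul, mul_pow, Real.norm_eq_abs, sq_abs] at hdesc
  simp only [conj_trivial] at hdesc
  have hval := hP.smoothedObjective_le μ xt s.lam (hP.primalUpdate_mem μ xt s.lamHat)
  rw [← hx] at hval
  have hhat : s.lamHat = (1 - s.θ) • s.lam + s.θ • s.z := by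
    simp only [LoopState.lamHat, LoopState.z]; module
  have hd : P.smoothedDual μ xt s.lamHat = (1 - s.θ) * P.smoothedObjective μ xt s.lam x +
      s.θ * P.smoothedObjective μ xt s.z x := by
    rw [smoothedDual, ← hx]
    simp only [smoothedObjective_eq]
    rw [hhat, inner_add_left, inner_smul_left, inner_smul_left]
    simp only [conj_trivial]; ring
  have hz : P.smoothedObjective μ xt s.z x = P.smoothedObjective μ xt lam x +
      inner ℝ (lam - s.z) (P.residual x) := by
    simp only [smoothedObjective_eq, inner_sub_left]; ring
  have hn : ‖lam - (s.z + (γ * μ * s.θ⁻¹) • P.residual x)‖ ^ 2 = ‖lam - s.z‖ ^ 2 -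
      2 * (γ * μ * s.θ⁻¹) * inner ℝ (lam - s.z) (P.residual x) +
      (γ * μ * s.θ⁻¹) ^ 2 * ‖P.residual x‖ ^ 2 := by
    rw [← sub_sub, norm_sub_sq_real, inner_smul_right, norm_smul, mul_pow, Real.norm_eq_abs,
      sq_abs]
    ring
  have htel : s.θ ^ 2 / (2 * (γ * μ)) * (‖lam - s.z‖ ^ 2 - (‖lam - s.z‖ ^ 2 -
      2 * (γ * μ * s.θ⁻¹) * inner ℝ (lam - s.z) (P.residual x) +
      (γ * μ * s.θ⁻¹) ^ 2 * ‖P.residual x‖ ^ 2)) =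
      s.θ * inner ℝ (lam - s.z) (P.residual x) - γ * μ / 2 * ‖P.residual x‖ ^ 2 := by
    field_simp; ring
  have hq : (γ * μ) ^ 2 * ‖P.residual x‖ ^ 2 / (2 * (γ * μ)) =
      γ * μ / 2 * ‖P.residual x‖ ^ 2 := by
    field_simp
  rw [hn, htel, hstep]
  rw [hq, hd, hz] at hdesc
  have := mul_le_mul_of_nonneg_left hval (show 0 ≤ 1 - s.θ by linarith)
  nlinarith

/-- The accelerated steps, weighted with `θ⁻²` and summed up. -/
theorem loop_potential_le (hP : P.IsConvexProgram) {γ μ : ℝ} (hγ : 0 < γ) (hμ : 0 < μ)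
    (hA : ∀ v, γ * ‖P.A.toEuclideanLin v‖ ^ 2 ≤ ‖v‖ ^ 2) (lam0 : EuclideanSpace ℝ m)
    (xt : EuclideanSpace ℝ k) (lam : EuclideanSpace ℝ m) (t : ℕ) :
    (P.loop γ μ lam0 xt t).S * P.smoothedDual μ xt (P.loop γ μ lam0 xt t).lam ≤
      ∑ s ∈ Finset.range t, (P.loop γ μ lam0 xt s).θ⁻¹ *
        P.smoothedObjective μ xt lam (P.loopPoint γ μ lam0 xt s) +
      (‖lam - lam0‖ ^ 2 - ‖lam - (P.loop γ μ lam0 xt t).z‖ ^ 2) / (2 * (γ * μ)) := by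
  induction t with
  | zero => simp [loop, LoopState.z]
  | succ t ih =>
    obtain ⟨h0, h1, -, hS, -⟩ := loop_theta (P := P) γ μ lam0 xt t
    have hstep := hP.smoothedDual_loopStep_le hγ hμ hA xt _ h0 h1 lam
    rw [← loop_succ] at hstep
    change _ ≤ _ + _ * P.smoothedObjective μ xt lam (P.loopPoint γ μ lam0 xt t) +
      _ * (_ - ‖lam - (_ + _ • P.residual (P.loopPoint γ μ lam0 xt t))‖ ^ 2) at hstep
    rw [← loop_z] at hstep
    have hS' : (P.loop γ μ lam0 xt (t + 1)).S = (P.loop γ μ lam0 xt t).θ⁻¹ ^ 2 := by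
      have : (P.loop γ μ lam0 xt (t + 1)).S =
        (P.loop γ μ lam0 xt t).S + (P.loop γ μ lam0 xt t).θ⁻¹ := by rw [loop_succ]; rfl
      rw [this, hS]; ring
    rw [hS', Finset.sum_range_succ]
    rw [hS] at ih
    have hm := mul_le_mul_of_nonneg_left hstep (sq_nonneg (P.loop γ μ lam0 xt t).θ⁻¹)
    refine hm.trans ?_
    generalize (P.loop γ μ lam0 xt t).θ = θ at *
    generalize P.smoothedDual μ xt (P.loop γ μ lam0 xt t).lam = φ at *
    have e : ∀ l a b : ℝ, θ⁻¹ ^ 2 * ((1 - θ) * φ + θ * l + θ ^ 2 / (2 * (γ * μ)) * (a - b)) =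
        (θ⁻¹ ^ 2 - θ⁻¹) * φ + θ⁻¹ * l + (a - b) / (2 * (γ * μ)) := by
      intro l a b
      field_simp
    rw [e]
    have : ∀ a b c : ℝ, (a - c) / (2 * (γ * μ)) =
        (a - b) / (2 * (γ * μ)) + (b - c) / (2 * (γ * μ)) := by intros; ring
    rw [this (‖lam - lam0‖ ^ 2) (‖lam - (P.loop γ μ lam0 xt t).z‖ ^ 2)]
    linarith

end IsConvexProgram

/-- The averaged primal point after `t` iterations of the loop. -/
noncomputable def loopAverage (P : Program m k) (γ μ : ℝ) (lam0 : EuclideanSpace ℝ m)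
    (xt : EuclideanSpace ℝ k) (t : ℕ) : EuclideanSpace ℝ k :=
  (P.loop γ μ lam0 xt t).S⁻¹ • (P.loop γ μ lam0 xt t).xSum

theorem loop_S_pos (γ μ : ℝ) (lam0 : EuclideanSpace ℝ m) (xt : EuclideanSpace ℝ k) {t : ℕ}
    (ht : 0 < t) : 0 < (P.loop γ μ lam0 xt t).S := by
  have : (0 : ℝ) < t := Nat.cast_pos.2 ht
  exact lt_of_lt_of_le (by positivity) (le_loop_S (P := P) γ μ lam0 xt t)

theorem loopAverage_eq (γ μ : ℝ) (lam0 : EuclideanSpace ℝ m) (xt : EuclideanSpace ℝ k) (t : ℕ) :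
    P.loopAverage γ μ lam0 xt t = ∑ s ∈ Finset.range t,
      ((P.loop γ μ lam0 xt t).S⁻¹ * (P.loop γ μ lam0 xt s).θ⁻¹) • P.loopPoint γ μ lam0 xt s := by
  rw [loopAverage, (loop_sums γ μ lam0 xt t).1, Finset.smul_sum]
  simp only [smul_smul]

theorem loop_weights (γ μ : ℝ) (lam0 : EuclideanSpace ℝ m) (xt : EuclideanSpace ℝ k) {t : ℕ}
    (ht : 0 < t) :
    ∑ s ∈ Finset.range t, (P.loop γ μ lam0 xt t).S⁻¹ * (P.loop γ μ lam0 xt s).θ⁻¹ = 1 := by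
  rw [← Finset.mul_sum, ← (loop_sums γ μ lam0 xt t).2]
  exact inv_mul_cancel₀ (loop_S_pos (P := P) γ μ lam0 xt ht).ne'

/-- The residual of the averaged point is the total displacement of the auxiliary sequence. -/
theorem residual_loopAverage (γ μ : ℝ) (lam0 : EuclideanSpace ℝ m) (xt : EuclideanSpace ℝ k)
    {t : ℕ} (ht : 0 < t) :
    (P.loop γ μ lam0 xt t).z - lam0 =
      (γ * μ * (P.loop γ μ lam0 xt t).S) • P.residual (P.loopAverage γ μ lam0 xt t) := by
  have hS := (loop_S_pos (P := P) γ μ lam0 xt ht).ne'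
  rw [loop_z_eq, add_sub_cancel_left, mul_smul (γ * μ)]
  congr 1
  simp only [residual, loopAverage, map_smul, smul_sub, smul_smul, mul_inv_cancel₀ hS, one_smul]
  rw [(loop_sums γ μ lam0 xt t).1, (loop_sums γ μ lam0 xt t).2]
  simp only [map_sum, map_smul, Finset.sum_smul, Finset.sum_sub_distrib]

namespace IsConvexProgram

theorem loopAverage_mem (hP : P.IsConvexProgram) (γ μ : ℝ) (lam0 : EuclideanSpace ℝ m)
    (xt : EuclideanSpace ℝ k) {t : ℕ} (ht : 0 < t) : P.loopAverage γ μ lam0 xt t ∈ P.X := by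
  rw [loopAverage_eq]
  refine hP.convex.1.sum_mem (fun s _ => ?_) (loop_weights γ μ lam0 xt ht)
    fun s _ => hP.primalUpdate_mem _ _ _
  exact mul_nonneg (inv_nonneg.2 (loop_S_pos (P := P) γ μ lam0 xt ht).le)
    (inv_nonneg.2 (loop_theta (P := P) γ μ lam0 xt s).1.le)

/-- The primal-dual guarantee of the accelerated loop, for every comparison multiplier `lam`. -/
theorem loop_primal_dual_le (hP : P.IsConvexProgram) {γ μ : ℝ} (hγ : 0 < γ) (hμ : 0 < μ)
    (hA : ∀ v, γ * ‖P.A.toEuclideanLin v‖ ^ 2 ≤ ‖v‖ ^ 2) (lam0 : EuclideanSpace ℝ m)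
    (xt : EuclideanSpace ℝ k) (lam : EuclideanSpace ℝ m) {t : ℕ} (ht : 0 < t) :
    P.smoothedDual μ xt (P.loop γ μ lam0 xt t).lam ≤
      P.smoothedObjective μ xt lam (P.loopAverage γ μ lam0 xt t) +
      (‖lam - lam0‖ ^ 2 - ‖lam - (P.loop γ μ lam0 xt t).z‖ ^ 2) /
        (2 * (γ * μ) * (P.loop γ μ lam0 xt t).S) := by
  have hpot := hP.loop_potential_le hγ hμ hA lam0 xt lam t
  have hS := loop_S_pos (P := P) γ μ lam0 xt ht
  have hw := loop_weights (P := P) γ μ lam0 xt ht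
  have hJ := (hP.convexOn_proxObjective hμ.le xt).map_sum_le (t := Finset.range t)
    (w := fun s => (P.loop γ μ lam0 xt t).S⁻¹ * (P.loop γ μ lam0 xt s).θ⁻¹)
    (p := P.loopPoint γ μ lam0 xt)
    (fun s _ => mul_nonneg (inv_nonneg.2 hS.le)
      (inv_nonneg.2 (loop_theta (P := P) γ μ lam0 xt s).1.le))
    hw (fun s _ => hP.primalUpdate_mem _ _ _)
  rw [← loopAverage_eq] at hJ
  have hlin : inner ℝ lam (P.residual (P.loopAverage γ μ lam0 xt t)) =
      ∑ s ∈ Finset.range t, (P.loop γ μ lam0 xt t).S⁻¹ * (P.loop γ μ lam0 xt s).θ⁻¹ *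
        inner ℝ lam (P.residual (P.loopPoint γ μ lam0 xt s)) := by
    have : P.residual (P.loopAverage γ μ lam0 xt t) = ∑ s ∈ Finset.range t,
        ((P.loop γ μ lam0 xt t).S⁻¹ * (P.loop γ μ lam0 xt s).θ⁻¹) •
          P.residual (P.loopPoint γ μ lam0 xt s) := by
      simp only [residual, smul_sub, Finset.sum_sub_distrib, ← Finset.sum_smul, hw, one_smul]
      rw [loopAverage_eq]
      simp only [map_sum, map_smul]
    rw [this, inner_sum]
    simp only [inner_smul_right]
  have hobj : (P.loop γ μ lam0 xt t).S⁻¹ * ∑ s ∈ Finset.range t, (P.loop γ μ lam0 xt s).θ⁻¹ *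
      P.smoothedObjective μ xt lam (P.loopPoint γ μ lam0 xt s) ≤
      P.smoothedObjective μ xt lam (P.loopAverage γ μ lam0 xt t) := by
    rw [smoothedObjective_eq, hlin]
    simp only [smoothedObjective_eq, mul_sub, mul_neg, Finset.sum_sub_distrib,
      Finset.sum_neg_distrib, Finset.mul_sum]
    simp only [smul_eq_mul] at hJ
    simp only [mul_assoc] at hJ ⊢
    linarith
  have hm := mul_le_mul_of_nonneg_left hpot (inv_nonneg.2 hS.le)
  rw [← mul_assoc, inv_mul_cancel₀ hS.ne', one_mul, mul_add] at hm
  refine hm.trans (add_le_add hobj (le_of_eq ?_))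
  field_simp

end IsConvexProgram

/-! ### Stages of the homotopy method under quadratic dual growth -/

/-- Quadratic growth of the dual function transversally to `Vᗮ`, where `V` contains all constraint
residuals, so that the dual function is constant along `Vᗮ`: the point `ν ∈ V` minimizes the dual,
and `‖proj_V lam - ν‖² ≤ C₀ (F lam - F ν)` wherever the gap `F lam - F ν` is at most `δ`. -/
structure QuadraticDualGrowth (P : Program m k) (V : Submodule ℝ (EuclideanSpace ℝ m))
    (ν : EuclideanSpace ℝ m) (δ C₀ : ℝ) : Prop where
  residual_mem : ∀ x, P.residual x ∈ V
  mem : ν ∈ V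
  isMin : ∀ lam, P.dual ν ≤ P.dual lam
  growth : ∀ lam, P.dual lam - P.dual ν ≤ δ →
    ‖V.starProjection lam - ν‖ ^ 2 ≤ C₀ * (P.dual lam - P.dual ν)

theorem dualObjective_congr {V : Submodule ℝ (EuclideanSpace ℝ m)}
    (hV : ∀ x, P.residual x ∈ V) {lam lam' : EuclideanSpace ℝ m} (h : lam - lam' ∈ Vᗮ) :
    P.dualObjective lam = P.dualObjective lam' := by
  funext x
  have : inner ℝ (lam - lam') (P.residual x) = 0 := Submodule.inner_left_of_mem_orthogonal (hV x) h
  rw [inner_sub_left] at this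
  simp only [dualObjective]
  linarith

theorem dual_congr {V : Submodule ℝ (EuclideanSpace ℝ m)}
    (hV : ∀ x, P.residual x ∈ V) {lam lam' : EuclideanSpace ℝ m} (h : lam - lam' ∈ Vᗮ) :
    P.dual lam = P.dual lam' := by
  rw [dual, dual, dualObjective_congr hV h]

namespace QuadraticDualGrowth

variable {V : Submodule ℝ (EuclideanSpace ℝ m)} {ν : EuclideanSpace ℝ m} {δ C₀ : ℝ}

/-- Replacing the `V`-component of `lam` by that of `ν` gives a dual minimizer. -/
theorem dual_shift (hG : P.QuadraticDualGrowth V ν δ C₀) (lam : EuclideanSpace ℝ m) :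
    P.dual (lam - V.starProjection lam + ν) = P.dual ν := by
  refine dual_congr hG.residual_mem ?_
  rw [add_sub_cancel_right]
  exact V.sub_starProjection_mem_orthogonal lam

theorem inner_shift (hG : P.QuadraticDualGrowth V ν δ C₀) (lam : EuclideanSpace ℝ m)
    (x : EuclideanSpace ℝ k) :
    inner ℝ (lam - V.starProjection lam + ν) (P.residual x) = inner ℝ ν (P.residual x) := by
  rw [inner_add_left, Submodule.inner_left_of_mem_orthogonal (hG.residual_mem x)
    (V.sub_starProjection_mem_orthogonal lam), zero_add]

variable {γ μ R : ℝ} {lam0 : EuclideanSpace ℝ m} {xt : EuclideanSpace ℝ k} {T : ℕ}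

/-- The guarantee of the loop, compared with the dual minimizer nearest to the starting
multiplier. -/
theorem smoothedObjective_shift_le (hG : P.QuadraticDualGrowth V ν δ C₀)
    (hP : P.IsConvexProgram) (hγ : 0 < γ)
    (hμ : 0 < μ) (hA : ∀ v, γ * ‖P.A.toEuclideanLin v‖ ^ 2 ≤ ‖v‖ ^ 2)
    (hT : 0 < T) (h0 : P.dual lam0 - P.dual ν ≤ δ) :
    P.smoothedDual μ xt (P.loop γ μ lam0 xt T).lam ≤
      P.smoothedObjective μ xt (lam0 - V.starProjection lam0 + ν) (P.loopAverage γ μ lam0 xt T) +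
      C₀ * (P.dual lam0 - P.dual ν) / (2 * (γ * μ) * (P.loop γ μ lam0 xt T).S) := by
  refine (hP.loop_primal_dual_le hγ hμ hA lam0 xt (lam0 - V.starProjection lam0 + ν) hT).trans ?_
  have hS := loop_S_pos (P := P) γ μ lam0 xt hT
  have e : lam0 - V.starProjection lam0 + ν - lam0 = -(V.starProjection lam0 - ν) := by abel
  have := hG.growth lam0 h0
  rw [e, norm_neg]
  gcongr
  have : 0 ≤ ‖lam0 - V.starProjection lam0 + ν - (P.loop γ μ lam0 xt T).z‖ ^ 2 := by positivity
  linarith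

theorem dual_gap_loop_le (hG : P.QuadraticDualGrowth V ν δ C₀) (hP : P.IsConvexProgram)
    (hγ : 0 < γ) (hμ : 0 < μ) (hA : ∀ v, γ * ‖P.A.toEuclideanLin v‖ ^ 2 ≤ ‖v‖ ^ 2)
    (hR : ∀ x ∈ P.X, ‖x - xt‖ ≤ R) (hT : 0 < T) (h0 : P.dual lam0 - P.dual ν ≤ δ) :
    P.dual (P.loop γ μ lam0 xt T).lam - P.dual ν ≤ μ / 2 * R ^ 2 +
      C₀ * (P.dual lam0 - P.dual ν) / (2 * (γ * μ) * (P.loop γ μ lam0 xt T).S) := by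
  have h1 := hG.smoothedObjective_shift_le (xt := xt) hP hγ hμ hA hT h0
  have h2 := hP.dual_le_smoothedDual hμ.le hR (P.loop γ μ lam0 xt T).lam
  have h3 := hP.smoothedObjective_le μ xt (lam0 - V.starProjection lam0 + ν)
    (hP.loopAverage_mem γ μ lam0 xt hT)
  have h4 := hP.smoothedDual_le_dual hμ.le xt (lam0 - V.starProjection lam0 + ν)
  rw [hG.dual_shift] at h4
  linarith

theorem objective_loopAverage_le (hG : P.QuadraticDualGrowth V ν δ C₀) (hP : P.IsConvexProgram)
    (hγ : 0 < γ) (hμ : 0 < μ) (hA : ∀ v, γ * ‖P.A.toEuclideanLin v‖ ^ 2 ≤ ‖v‖ ^ 2)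
    (hR : ∀ x ∈ P.X, ‖x - xt‖ ≤ R) (hT : 0 < T) (h0 : P.dual lam0 - P.dual ν ≤ δ) :
    P.f (P.loopAverage γ μ lam0 xt T) ≤ -P.dual ν +
      ‖ν‖ * ‖P.residual (P.loopAverage γ μ lam0 xt T)‖ + (μ / 2 * R ^ 2 +
      C₀ * (P.dual lam0 - P.dual ν) / (2 * (γ * μ) * (P.loop γ μ lam0 xt T).S)) := by
  have h1 := hG.smoothedObjective_shift_le (xt := xt) hP hγ hμ hA hT h0
  have h2 := hP.dual_le_smoothedDual hμ.le hR (P.loop γ μ lam0 xt T).lam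
  have h3 := hG.isMin (P.loop γ μ lam0 xt T).lam
  have h4 := neg_le_of_abs_le
    (abs_real_inner_le_norm ν (P.residual (P.loopAverage γ μ lam0 xt T)))
  have h5 : 0 ≤ μ / 2 * ‖P.loopAverage γ μ lam0 xt T - xt‖ ^ 2 := by positivity
  simp only [smoothedObjective, dualObjective, hG.inner_shift] at h1
  linarith

/-- The displacement of the auxiliary sequence is controlled by the distance of the starting
multiplier to minimizers of the *smoothed* dual. Such minimizers have dual gap at most `μ R²`, so
quadratic growth places them at distance `O(√(μ R²))`. Comparing with a minimizer of the dual
itself would leave a residual of order `1/√S`, which is too large for the final rate. -/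
theorem norm_residual_loopAverage_le (hG : P.QuadraticDualGrowth V ν δ C₀)
    (hP : P.IsConvexProgram) (hC₀ : 0 ≤ C₀)
    (hγ : 0 < γ) (hμ : 0 < μ) (hA : ∀ v, γ * ‖P.A.toEuclideanLin v‖ ^ 2 ≤ ‖v‖ ^ 2)
    (hR0 : 0 < R) (hR : ∀ x ∈ P.X, ‖x - xt‖ ≤ R) (hT : 0 < T)
    (h0 : P.dual lam0 - P.dual ν ≤ 2 * (μ * R ^ 2)) (hδ : 2 * (μ * R ^ 2) ≤ δ) :
    γ * μ * (P.loop γ μ lam0 xt T).S * ‖P.residual (P.loopAverage γ μ lam0 xt T)‖ ≤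
      (4 * √(2 * C₀) + 1) * √(μ * R ^ 2) := by
  have hS := loop_S_pos (P := P) γ μ lam0 xt hT
  have hE : 0 < μ * R ^ 2 := by positivity
  have hden : 0 < 2 * (γ * μ) * (P.loop γ μ lam0 xt T).S := by positivity
  set E := μ * R ^ 2 with hEdef
  -- `κ` is the tolerance of a near minimizer of the smoothed dual, which spares its attainment
  obtain ⟨κ, hκ0, hκ1, hκ2⟩ : ∃ κ : ℝ, 0 < κ ∧ κ ≤ E / 2 ∧
      κ * (2 * (γ * μ) * (P.loop γ μ lam0 xt T).S) ≤ E := by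
    refine ⟨min (E / 2) (E / (2 * (γ * μ) * (P.loop γ μ lam0 xt T).S)), by positivity,
      min_le_left _ _, ?_⟩
    rw [← le_div_iff₀ hden]
    exact min_le_right _ _
  have hlow : ∀ lam, P.dual lam ≤ P.smoothedDual μ xt lam + E / 2 := fun lam => by
    have := hP.dual_le_smoothedDual hμ.le hR lam
    rw [hEdef]; linarith
  have hbdd : BddBelow (range (P.smoothedDual μ xt)) := by
    refine ⟨P.dual ν - E / 2, ?_⟩
    rintro _ ⟨lam, rfl⟩
    have := hlow lam
    have := hG.isMin lam
    linarith
  obtain ⟨_, ⟨lam₁, rfl⟩, hlam₁⟩ := exists_lt_of_csInf_lt (range_nonempty (P.smoothedDual μ xt))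
    (lt_add_of_pos_right (sInf (range (P.smoothedDual μ xt))) hκ0)
  have hinf : ∀ lam, sInf (range (P.smoothedDual μ xt)) ≤ P.smoothedDual μ xt lam :=
    fun lam => csInf_le hbdd ⟨lam, rfl⟩
  have hgap₁ : P.dual lam₁ - P.dual ν ≤ E := by
    have := hlow lam₁
    have := hinf ν
    have := hP.smoothedDual_le_dual hμ.le xt ν
    linarith
  have hg0 := hG.growth lam0 (by linarith)
  have hg1 := hG.growth lam₁ (by linarith)
  have hsq : ∀ {lam}, P.dual lam - P.dual ν ≤ 2 * E →
      ‖V.starProjection lam - ν‖ ^ 2 ≤ C₀ * (P.dual lam - P.dual ν) →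
      ‖V.starProjection lam - ν‖ ≤ √(2 * C₀) * √E := by
    intro lam h h'
    rw [← Real.sqrt_mul (by positivity)]
    refine Real.le_sqrt_of_sq_le (h'.trans ?_)
    nlinarith
  have hn0 := hsq h0 hg0
  have hn1 := hsq (by linarith) hg1
  -- `lam₂` has the `V`-component of the near minimizer `lam₁` and the `Vᗮ`-component of `lam0`
  set lam₂ := lam0 - V.starProjection lam0 + V.starProjection lam₁ with hlam₂
  have hdist : ‖lam₂ - lam0‖ ≤ 2 * (√(2 * C₀) * √E) := by
    have e : lam₂ - lam0 = (V.starProjection lam₁ - ν) - (V.starProjection lam0 - ν) := by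
      rw [hlam₂]; abel
    rw [e]
    exact (norm_sub_le _ _).trans (by linarith)
  have hobj : P.smoothedObjective μ xt lam₂ = P.smoothedObjective μ xt lam₁ := by
    funext x
    simp only [smoothedObjective]
    rw [dualObjective_congr hG.residual_mem (lam' := lam₁)]
    have e : lam₂ - lam₁ =
        (lam0 - V.starProjection lam0) - (lam₁ - V.starProjection lam₁) := by rw [hlam₂]; abel
    rw [e]
    exact Submodule.sub_mem _ (V.sub_starProjection_mem_orthogonal _)
      (V.sub_starProjection_mem_orthogonal _)
  have hpd := hP.loop_primal_dual_le hγ hμ hA lam0 xt lam₂ hT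
  rw [hobj] at hpd
  have h3 := hP.smoothedObjective_le μ xt lam₁ (hP.loopAverage_mem γ μ lam0 xt hT)
  have h4 := hinf (P.loop γ μ lam0 xt T).lam
  have h5 : -κ ≤ (‖lam₂ - lam0‖ ^ 2 - ‖lam₂ - (P.loop γ μ lam0 xt T).z‖ ^ 2) /
      (2 * (γ * μ) * (P.loop γ μ lam0 xt T).S) := by linarith
  rw [le_div_iff₀ hden] at h5
  have hz : ‖lam₂ - (P.loop γ μ lam0 xt T).z‖ ≤ ‖lam₂ - lam0‖ + √E := by
    refine abs_le_of_sq_le_sq' ?_ (by positivity) |>.2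
    have : 0 ≤ ‖lam₂ - lam0‖ * √E := by positivity
    rw [add_sq, Real.sq_sqrt hE.le]
    linarith
  have hres := congrArg norm (residual_loopAverage (P := P) γ μ lam0 xt hT)
  rw [norm_smul, Real.norm_eq_abs, abs_of_pos (by positivity)] at hres
  rw [← hres]
  have e : (P.loop γ μ lam0 xt T).z - lam0 =
      (lam₂ - lam0) - (lam₂ - (P.loop γ μ lam0 xt T).z) := by abel
  rw [e]
  refine (norm_sub_le _ _).trans ?_
  linarith

end QuadraticDualGrowth

/-! ### Convergence time of the homotopy method -/

theorem homotopy_succ (γ R ε0 : ℝ) (x0 : EuclideanSpace ℝ k) (T K : ℕ) :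
    P.homotopy γ R ε0 x0 T (K + 1) = P.stage γ T (P.homotopy γ R ε0 x0 T K) := by
  simp only [homotopy, Function.iterate_succ_apply']

theorem homotopy_mu (γ R ε0 : ℝ) (x0 : EuclideanSpace ℝ k) (T K : ℕ) :
    (P.homotopy γ R ε0 x0 T K).μ = ε0 / 2 ^ K / R ^ 2 := by
  induction K with
  | zero => simp [homotopy]
  | succ K ih =>
    rw [homotopy_succ]
    change (P.homotopy γ R ε0 x0 T K).μ / 2 = _
    rw [ih, pow_succ]
    ring

theorem homotopy_steps (γ R ε0 : ℝ) (x0 : EuclideanSpace ℝ k) (T K : ℕ) :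
    (P.homotopy γ R ε0 x0 T K).steps = K * T := by
  induction K with
  | zero => simp [homotopy]
  | succ K ih =>
    rw [homotopy_succ]
    simp only [stage, loop_steps, ih]
    ring

theorem homotopy_succ_lam (γ R ε0 : ℝ) (x0 : EuclideanSpace ℝ k) (T K : ℕ) :
    (P.homotopy γ R ε0 x0 T (K + 1)).lam = (P.loop γ (ε0 / 2 ^ (K + 1) / R ^ 2)
      (P.homotopy γ R ε0 x0 T K).lam (P.homotopy γ R ε0 x0 T K).x T).lam := by
  rw [← homotopy_mu (P := P) γ R ε0 x0 T, homotopy_succ]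
  rfl

theorem homotopy_succ_x (γ R ε0 : ℝ) (x0 : EuclideanSpace ℝ k) (T K : ℕ) :
    (P.homotopy γ R ε0 x0 T (K + 1)).x = P.loopAverage γ (ε0 / 2 ^ (K + 1) / R ^ 2)
      (P.homotopy γ R ε0 x0 T K).lam (P.homotopy γ R ε0 x0 T K).x T := by
  rw [← homotopy_mu (P := P) γ R ε0 x0 T, homotopy_succ]
  rfl

theorem IsConvexProgram.homotopy_mem (hP : P.IsConvexProgram) (γ R ε0 : ℝ)
    {x0 : EuclideanSpace ℝ k} (hx0 : x0 ∈ P.X) {T : ℕ} (hT : 0 < T) (K : ℕ) :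
    (P.homotopy γ R ε0 x0 T K).x ∈ P.X := by
  cases K with
  | zero => exact hx0
  | succ K =>
    rw [homotopy_succ_x]
    exact hP.loopAverage_mem _ _ _ _ hT

section Rate

variable {V : Submodule ℝ (EuclideanSpace ℝ m)} {ν : EuclideanSpace ℝ m} {δ C₀ γ R ε0 : ℝ}
  {x0 : EuclideanSpace ℝ k} {T : ℕ}

/-- Halving of the smoothing error and a gap of at most `2 E` at the start of a stage make the
error terms of the stage at most `E`, once `T² ≥ 8 C₀ R² / (γ E)`. -/
theorem stage_error_le {E S g : ℝ} (hγ : 0 < γ) (hR : 0 < R) (hE : 0 < E) (hC₀ : 0 ≤ C₀)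
    (hS : (T : ℝ) ^ 2 / 4 ≤ S) (hT : 0 < T) (hg : g ≤ 2 * E)
    (hTE : 8 * C₀ * R ^ 2 ≤ γ * (T : ℝ) ^ 2 * E) :
    E / R ^ 2 / 2 * R ^ 2 + C₀ * g / (2 * (γ * (E / R ^ 2)) * S) ≤ E := by
  have hT' : (0 : ℝ) < T := Nat.cast_pos.2 hT
  have hS0 : 0 < S := lt_of_lt_of_le (by positivity) hS
  have h1 : E / R ^ 2 / 2 * R ^ 2 = E / 2 := by field_simp
  have h2 : C₀ * g / (2 * (γ * (E / R ^ 2)) * S) ≤ E / 2 := by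
    rw [div_le_iff₀ (by positivity)]
    have e : E / 2 * (2 * (γ * (E / R ^ 2)) * S) = γ * S * E * E / R ^ 2 := by field_simp
    rw [e, le_div_iff₀ (by positivity)]
    have h3 : C₀ * g ≤ C₀ * (2 * E) := by gcongr
    have h4 : γ * ((T : ℝ) ^ 2 / 4) * E * E ≤ γ * S * E * E := by gcongr
    have h5 : C₀ * g * R ^ 2 ≤ C₀ * (2 * E) * R ^ 2 := by gcongr
    nlinarith
  linarith

theorem QuadraticDualGrowth.dual_gap_homotopy_le (hG : P.QuadraticDualGrowth V ν ε0 C₀)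
    (hP : P.IsConvexProgram) (hC₀ : 0 ≤ C₀) (hγ : 0 < γ) (hε0 : 0 < ε0)
    (hA : ∀ v, γ * ‖P.A.toEuclideanLin v‖ ^ 2 ≤ ‖v‖ ^ 2)
    (hR0 : 0 < R) (hR : ∀ x ∈ P.X, ∀ y ∈ P.X, ‖x - y‖ ≤ R) (hx0 : x0 ∈ P.X) (hT : 0 < T)
    (h0 : P.dual 0 - P.dual ν ≤ ε0) (K : ℕ)
    (hTK : 8 * C₀ * R ^ 2 ≤ γ * (T : ℝ) ^ 2 * (ε0 / 2 ^ K)) :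
    P.dual (P.homotopy γ R ε0 x0 T K).lam - P.dual ν ≤ ε0 / 2 ^ K := by
  induction K with
  | zero => simpa [homotopy] using h0
  | succ K ih =>
    have he : ε0 / 2 ^ K = 2 * (ε0 / 2 ^ (K + 1)) := by rw [pow_succ]; field_simp
    have hE : 0 < ε0 / 2 ^ (K + 1) := by positivity
    have hih := ih (hTK.trans (by gcongr <;> linarith))
    have hle : ε0 / 2 ^ K ≤ ε0 := div_le_self hε0.le (one_le_pow₀ one_le_two)
    have hx := hP.homotopy_mem γ R ε0 hx0 hT K
    rw [homotopy_succ_lam]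
    refine (hG.dual_gap_loop_le hP hγ (by positivity) hA (fun x hx' => hR x hx' _ hx) hT
      (hih.trans hle)).trans ?_
    exact stage_error_le hγ hR0 hE hC₀ (le_loop_S _ _ _ _ _) hT (he ▸ hih) hTK

/-- Under quadratic growth of the dual, the homotopy method needs stages of length
`O(ε ^ (-4/5))` only. -/
theorem QuadraticDualGrowth.exists_homotopy_rate (hG : P.QuadraticDualGrowth V ν ε0 C₀)
    (hP : P.IsConvexProgram) (hfeas : ∃ x ∈ P.X, P.residual x = 0) (hC₀ : 0 ≤ C₀) (hγ : 0 < γ)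
    (hε0 : 1 ≤ ε0) (hA : ∀ v, γ * ‖P.A.toEuclideanLin v‖ ^ 2 ≤ ‖v‖ ^ 2)
    (hR0 : 0 < R) (hR : ∀ x ∈ P.X, ∀ y ∈ P.X, ‖x - y‖ ≤ R)
    (h0 : P.dual 0 - P.dual ν ≤ ε0) :
    ∃ c C : ℝ, 0 < c ∧ 0 < C ∧ ∀ ε : ℝ, 0 < ε → ε ≤ 1 / 2 → ∀ x0 ∈ P.X,
      (∀ T : ℕ, c * ε ^ (-(4 / 5) : ℝ) ≤ T → P.IsApproxSolution C ε
        (P.homotopy γ R ε0 x0 T (⌈Real.logb 2 (ε0 / ε)⌉₊ + 1)).x) ∧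
      ((P.homotopy γ R ε0 x0 ⌈c * ε ^ (-(4 / 5) : ℝ)⌉₊
        (⌈Real.logb 2 (ε0 / ε)⌉₊ + 1)).steps : ℝ) ≤
        C * ε ^ (-(4 / 5) : ℝ) * Real.logb 2 (1 / ε) := by
  set c : ℝ := 1 + 32 * C₀ * R ^ 2 / γ with hc
  set B : ℝ := 4 * √(2 * C₀) + 1 with hB
  set C₁ : ℝ := 8 * B * R ^ 2 / γ with hC₁
  have hB0 : 0 < B := by positivity
  have hC₁0 : 0 < C₁ := by positivity
  have hc1 : 1 ≤ c := by rw [hc]; linarith [show 0 ≤ 32 * C₀ * R ^ 2 / γ by positivity]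
  have hl0 : 0 ≤ Real.logb 2 ε0 := Real.logb_nonneg one_lt_two hε0
  refine ⟨c, C₁ * (‖ν‖ + 1) + 1 + (Real.logb 2 ε0 + 3) * (c + 1), by linarith, by positivity, ?_⟩
  intro ε hε hε2 x0 hx0
  have hK0 : 0 ≤ Real.logb 2 (ε0 / ε) :=
    Real.logb_nonneg one_lt_two (by rw [le_div_iff₀ hε]; linarith)
  have hpow : (2 : ℝ) ^ Real.logb 2 (ε0 / ε) = ε0 / ε :=
    Real.rpow_logb two_pos (by norm_num) (by positivity)
  set K := ⌈Real.logb 2 (ε0 / ε)⌉₊ with hK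
  constructor
  · intro T hT
    have hrp : 0 < ε ^ (-(4 / 5) : ℝ) := Real.rpow_pos_of_pos hε _
    have hT0 : 0 < T := by
      have : (0 : ℝ) < T := lt_of_lt_of_le (by positivity) hT
      exact_mod_cast this
    have hTr : (0 : ℝ) < T := Nat.cast_pos.2 hT0
    -- the accuracy `E` of the last stage is comparable with `ε`
    set E := ε0 / 2 ^ (K + 1) with hE
    have hE1 : E ≤ ε / 2 := by
      have h1 : ε0 / ε ≤ 2 ^ K := by
        rw [← hpow, ← Real.rpow_natCast]
        exact Real.rpow_le_rpow_of_exponent_le one_le_two (Nat.le_ceil _)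
      rw [div_le_iff₀ hε] at h1
      rw [hE, div_le_iff₀ (by positivity), pow_succ]
      linarith
    have hE2 : ε / 4 ≤ E := by
      have h1 : (2 : ℝ) ^ K ≤ 2 * (ε0 / ε) := by
        rw [← hpow, ← Real.rpow_natCast]
        calc (2 : ℝ) ^ ((K : ℕ) : ℝ) ≤ 2 ^ (1 + Real.logb 2 (ε0 / ε)) :=
              Real.rpow_le_rpow_of_exponent_le one_le_two
                (by linarith [(Nat.ceil_lt_add_one hK0).le])
          _ = 2 * 2 ^ Real.logb 2 (ε0 / ε) := by rw [Real.rpow_add two_pos, Real.rpow_one]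
      rw [← mul_div_assoc, le_div_iff₀ hε] at h1
      rw [hE, le_div_iff₀ (by positivity), pow_succ]
      linarith
    have hEpos : 0 < E := by positivity
    have hs0 : 0 < √ε := Real.sqrt_pos.2 hε
    have hs1 : √ε ≤ 1 := Real.sqrt_le_one.2 (by linarith)
    -- the residual bound only uses `T² ≥ c² ε ^ (-3/2)`, which is weaker than the hypothesis on `T`
    have hcT : c ^ 2 ≤ (T : ℝ) ^ 2 * ε * √ε := by
      have h1 : c ≤ T * ε ^ (3 / 4 : ℝ) := by
        calc c = c * ε ^ (-(4 / 5) : ℝ) * ε ^ (4 / 5 : ℝ) := by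
              rw [mul_assoc, ← Real.rpow_add hε]; norm_num
          _ ≤ T * ε ^ (4 / 5 : ℝ) := by gcongr
          _ ≤ T * ε ^ (3 / 4 : ℝ) := by
              gcongr ?_ * ?_
              exact Real.rpow_le_rpow_of_exponent_ge hε (by linarith) (by norm_num)
      have h2 : (ε ^ (3 / 4 : ℝ)) ^ 2 = ε * √ε := by
        rw [Real.sqrt_eq_rpow, ← Real.rpow_natCast, ← Real.rpow_mul hε.le]
        nth_rewrite 2 [← Real.rpow_one ε]
        rw [← Real.rpow_add hε]
        norm_num
      calc c ^ 2 ≤ (T * ε ^ (3 / 4 : ℝ)) ^ 2 := by gcongr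
        _ = (T : ℝ) ^ 2 * ε * √ε := by rw [mul_pow, h2, mul_assoc]
    have hcT1 : c ≤ (T : ℝ) ^ 2 * ε * √ε := le_trans (by nlinarith) hcT
    have hcT2 : c ≤ (T : ℝ) ^ 2 * ε := hcT1.trans (mul_le_of_le_one_right (by positivity) hs1)
    have hTE : 8 * C₀ * R ^ 2 ≤ γ * (T : ℝ) ^ 2 * E := by
      have h1 : 32 * C₀ * R ^ 2 / γ ≤ (T : ℝ) ^ 2 * ε := by linarith
      rw [div_le_iff₀ hγ] at h1
      have : γ * (T : ℝ) ^ 2 * (ε / 4) ≤ γ * (T : ℝ) ^ 2 * E := by gcongr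
      linarith
    have he : ε0 / 2 ^ K = 2 * E := by rw [hE, pow_succ]; field_simp
    have hx := hP.homotopy_mem γ R ε0 hx0 hT0 K
    have hgap := hG.dual_gap_homotopy_le hP hC₀ hγ (by linarith) hA hR0 hR hx0 hT0 h0 K
      (hTE.trans (by rw [he]; gcongr; linarith))
    have hle : 2 * E ≤ ε0 := he ▸ div_le_self (by linarith) (one_le_pow₀ one_le_two)
    rw [he] at hgap
    have hμ : 0 < E / R ^ 2 := by positivity
    have hμR : E / R ^ 2 * R ^ 2 = E := by field_simp
    have hS := le_loop_S (P := P) γ (E / R ^ 2) (P.homotopy γ R ε0 x0 T K).lam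
      (P.homotopy γ R ε0 x0 T K).x T
    have hres := hG.norm_residual_loopAverage_le hP hC₀ hγ hμ hA hR0
      (fun x hx' => hR x hx' _ hx) hT0 (by rw [hμR]; exact hgap) (by rw [hμR]; exact hle)
    have hobj := hG.objective_loopAverage_le hP hγ hμ hA
      (fun x hx' => hR x hx' _ hx) hT0 (hgap.trans hle)
    have herr := stage_error_le hγ hR0 hEpos hC₀ hS hT0 hgap hTE
    rw [hμR] at hres
    have hopt := hP.primalOpt_ge hfeas ν
    have hmem := hP.homotopy_mem γ R ε0 hx0 hT0 (K + 1)
    rw [homotopy_succ_x, ← hE] at hmem ⊢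
    set S := (P.loop γ (E / R ^ 2) (P.homotopy γ R ε0 x0 T K).lam
      (P.homotopy γ R ε0 x0 T K).x T).S
    set x := P.loopAverage γ (E / R ^ 2) (P.homotopy γ R ε0 x0 T K).lam
      (P.homotopy γ R ε0 x0 T K).x T
    have hr : ‖P.residual x‖ ≤ C₁ * ε := by
      have hsE : 0 < √E := Real.sqrt_pos.2 hEpos
      have hsE2 : √E * √E = E := Real.mul_self_sqrt hEpos.le
      have hsE1 : √ε / 2 ≤ √E := by
        refine Real.le_sqrt_of_sq_le ?_
        rw [div_pow, Real.sq_sqrt hε.le]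
        linarith
      have h1 : γ * (E / R ^ 2) * ((T : ℝ) ^ 2 / 4) * ‖P.residual x‖ ≤ B * √E :=
        le_trans (by gcongr) hres
      have h2 : γ * (T : ℝ) ^ 2 * √E * ‖P.residual x‖ ≤ 4 * B * R ^ 2 := by
        have e : γ * (E / R ^ 2) * ((T : ℝ) ^ 2 / 4) * ‖P.residual x‖ =
            √E * (γ * (T : ℝ) ^ 2 * √E * ‖P.residual x‖ / (4 * R ^ 2)) := by
          have e' : ∀ q : ℝ, γ * (q * q / R ^ 2) * ((T : ℝ) ^ 2 / 4) * ‖P.residual x‖ =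
              q * (γ * (T : ℝ) ^ 2 * q * ‖P.residual x‖ / (4 * R ^ 2)) := by
            intro q; field_simp
          rw [← e', hsE2]
        rw [e, mul_comm B] at h1
        have h3 := le_of_mul_le_mul_left h1 hsE
        rw [div_le_iff₀ (by positivity)] at h3
        linarith
      have h3 : γ * (T : ℝ) ^ 2 * (√ε / 2) * ‖P.residual x‖ ≤ 4 * B * R ^ 2 :=
        le_trans (by gcongr) h2
      have h4 : ‖P.residual x‖ ≤ (T : ℝ) ^ 2 * ε * √ε * ‖P.residual x‖ :=
        le_mul_of_one_le_left (norm_nonneg _) (hc1.trans hcT1)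
      have e : C₁ * ε = (8 * B * R ^ 2) * ε / γ := by rw [hC₁]; ring
      rw [e, le_div_iff₀ hγ]
      have h5 := mul_le_mul_of_nonneg_right h3 (show 0 ≤ 2 * ε by positivity)
      have h6 := mul_le_mul_of_nonneg_right h4 hγ.le
      linarith
    have hrν : ‖ν‖ * ‖P.residual x‖ ≤ ‖ν‖ * (C₁ * ε) := by gcongr
    have hst : 0 ≤ (Real.logb 2 ε0 + 3) * (c + 1) * ε := by positivity
    have hνε : 0 ≤ C₁ * ‖ν‖ * ε := by positivity
    have hCε : 0 ≤ C₁ * ε := by positivity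
    refine ⟨hmem, ?_, ?_⟩
    · linarith
    · linarith
  · rw [homotopy_steps]
    have hrp : 1 ≤ ε ^ (-(4 / 5) : ℝ) :=
      Real.one_le_rpow_of_pos_of_le_one_of_nonpos hε (by linarith) (by norm_num)
    have hL : 1 ≤ Real.logb 2 (1 / ε) := by
      rw [Real.le_logb_iff_rpow_le one_lt_two (by positivity), Real.rpow_one, le_div_iff₀ hε]
      linarith
    have hlog : Real.logb 2 (ε0 / ε) = Real.logb 2 ε0 + Real.logb 2 (1 / ε) := by
      rw [← Real.logb_mul (by positivity) (by positivity), mul_one_div]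
    have hKL : ((K + 1 : ℕ) : ℝ) ≤ (Real.logb 2 ε0 + 3) * Real.logb 2 (1 / ε) := by
      have := (Nat.ceil_lt_add_one hK0).le
      push_cast
      nlinarith
    have hTc : (⌈c * ε ^ (-(4 / 5) : ℝ)⌉₊ : ℝ) ≤ (c + 1) * ε ^ (-(4 / 5) : ℝ) := by
      have := (Nat.ceil_lt_add_one (show 0 ≤ c * ε ^ (-(4 / 5) : ℝ) by positivity)).le
      linarith
    rw [Nat.cast_mul]
    calc ((K + 1 : ℕ) : ℝ) * (⌈c * ε ^ (-(4 / 5) : ℝ)⌉₊ : ℝ)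
        ≤ ((Real.logb 2 ε0 + 3) * Real.logb 2 (1 / ε)) * ((c + 1) * ε ^ (-(4 / 5) : ℝ)) := by
          gcongr
      _ = ((Real.logb 2 ε0 + 3) * (c + 1)) * ε ^ (-(4 / 5) : ℝ) * Real.logb 2 (1 / ε) := by ring
      _ ≤ _ := by
          gcongr
          linarith [show 0 ≤ C₁ * (‖ν‖ + 1) by positivity]

end Rate

/-! ### Dual minimizers and error bounds from quadratic dual growth -/

namespace QuadraticDualGrowth

variable {V : Submodule ℝ (EuclideanSpace ℝ m)} {ν : EuclideanSpace ℝ m} {δ C₀ : ℝ}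

theorem minimizers_eq (hG : P.QuadraticDualGrowth V ν δ C₀) (hδ : 0 ≤ δ) :
    minimizers P.dual = {lam | V.starProjection lam = ν} := by
  ext lam
  constructor
  · intro h
    have h0 : P.dual lam - P.dual ν = 0 := sub_eq_zero.2 (le_antisymm (h ν) (hG.isMin lam))
    have := hG.growth lam (h0 ▸ hδ)
    rw [h0, mul_zero] at this
    exact sub_eq_zero.1 (norm_eq_zero.1 (pow_eq_zero_iff two_ne_zero |>.1
      (le_antisymm this (sq_nonneg _))))
  · intro h lam'
    have hl : V.starProjection lam = ν := h
    have := hG.dual_shift lam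
    rw [hl, sub_add_cancel] at this
    rw [this]
    exact hG.isMin lam'

theorem minValue_eq (hG : P.QuadraticDualGrowth V ν δ C₀) : minValue P.dual = P.dual ν := by
  refine IsLeast.csInf_eq ⟨⟨ν, rfl⟩, ?_⟩
  rintro _ ⟨lam, rfl⟩
  exact hG.isMin lam

theorem localErrorBound (hG : P.QuadraticDualGrowth V ν δ C₀) (hP : P.IsConvexProgram)
    (hC₀ : 0 ≤ C₀) : LocalErrorBound P.dual (1 / 2) δ := by
  refine ⟨by norm_num, by norm_num, hP.convexOn_dual, ⟨ν, hG.isMin⟩, √C₀ + 1, by positivity, ?_⟩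
  intro lam hlam
  change P.dual lam - minValue P.dual ≤ δ at hlam
  rw [hG.minValue_eq] at hlam ⊢
  have hgap := sub_nonneg.2 (hG.isMin lam)
  have hmem : lam - V.starProjection lam + ν ∈ minimizers P.dual := by
    intro lam'
    rw [hG.dual_shift]
    exact hG.isMin lam'
  rw [← Real.sqrt_eq_rpow]
  calc Metric.infDist lam (minimizers P.dual)
      ≤ dist lam (lam - V.starProjection lam + ν) := Metric.infDist_le_dist_of_mem hmem
    _ = ‖V.starProjection lam - ν‖ := by rw [dist_eq_norm]; congr 1; abel
    _ ≤ √(C₀ * (P.dual lam - P.dual ν)) := Real.le_sqrt_of_sq_le (hG.growth lam hlam)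
    _ = √C₀ * √(P.dual lam - P.dual ν) := Real.sqrt_mul hC₀ _
    _ ≤ (√C₀ + 1) * √(P.dual lam - P.dual ν) := by gcongr; linarith

end QuadraticDualGrowth

end Program

/-! ### Block vectors and the constraint matrix -/

section Blocks

variable {n d : ℕ}

theorem block_apply (x : EuclideanSpace ℝ (Fin n × Fin d)) (i : Fin n) (l : Fin d) :
    block x i l = x (i, l) := rfl

theorem block_stack (v : Fin n → EuclideanSpace ℝ (Fin d)) (i : Fin n) :
    block (stack v) i = v i := rfl

theorem block_add (x y : EuclideanSpace ℝ (Fin n × Fin d)) (i : Fin n) :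
    block (x + y) i = block x i + block y i := rfl

theorem block_sub (x y : EuclideanSpace ℝ (Fin n × Fin d)) (i : Fin n) :
    block (x - y) i = block x i - block y i := rfl

theorem block_smul (c : ℝ) (x : EuclideanSpace ℝ (Fin n × Fin d)) (i : Fin n) :
    block (c • x) i = c • block x i := rfl

theorem continuous_block (i : Fin n) :
    Continuous fun x : EuclideanSpace ℝ (Fin n × Fin d) => block x i := by
  unfold block
  fun_prop

theorem inner_eq_sum_block (x y : EuclideanSpace ℝ (Fin n × Fin d)) :
    inner ℝ x y = ∑ i, inner ℝ (block x i) (block y i) := by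
  simp only [PiLp.inner_apply, block_apply, Fintype.sum_prod_type]

theorem norm_sq_eq_sum_block (x : EuclideanSpace ℝ (Fin n × Fin d)) :
    ‖x‖ ^ 2 = ∑ i, ‖block x i‖ ^ 2 := by
  rw [← real_inner_self_eq_norm_sq, inner_eq_sum_block]
  simp only [real_inner_self_eq_norm_sq]

theorem consMatrix_apply (W : Matrix (Fin n) (Fin n) ℝ) (r c : Fin n × Fin d) :
    consMatrix d W r c = (1 - W) r.1 c.1 * (1 : Matrix (Fin d) (Fin d) ℝ) r.2 c.2 := by
  simp only [consMatrix, Matrix.of_apply, blockW, Matrix.sub_apply]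
  split_ifs with h
  · rw [h]
    simp
  · simp [h]

theorem consMatrix_toEuclideanLin_apply (W : Matrix (Fin n) (Fin n) ℝ)
    (x : EuclideanSpace ℝ (Fin n × Fin d)) (i : Fin n) (l : Fin d) :
    (consMatrix d W).toEuclideanLin x (i, l) = (1 - W).mulVec (fun j => x (j, l)) i := by
  rw [Matrix.ofLp_toLpLin, Matrix.toLin'_apply, Matrix.mulVec, Matrix.mulVec]
  simp only [dotProduct, Fintype.sum_prod_type, consMatrix_apply]
  refine Finset.sum_congr rfl fun j _ => ?_
  simp [Matrix.one_apply]

theorem colBlock_transpose_apply (A : Matrix (Fin n × Fin d) (Fin n × Fin d) ℝ) (i : Fin n)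
    (lam : EuclideanSpace ℝ (Fin n × Fin d)) :
    (colBlock A i).transpose.toEuclideanLin lam = block (A.transpose.toEuclideanLin lam) i := rfl

variable {G : SimpleGraph (Fin n)} {W : Matrix (Fin n) (Fin n) ℝ}

theorem IsMixingMatrix.consMatrix_transpose (hW : IsMixingMatrix G W) :
    (consMatrix d W).transpose = consMatrix d W := by
  ext r c
  rw [Matrix.transpose_apply, consMatrix_apply, consMatrix_apply, ← Matrix.transpose_apply (1 - W),
    ← Matrix.transpose_apply (1 : Matrix (Fin d) (Fin d) ℝ), Matrix.transpose_sub,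
    Matrix.transpose_one, Matrix.transpose_one, hW.symm]

theorem IsMixingMatrix.isSymmetric (hW : IsMixingMatrix G W) :
    (consMatrix d W).toEuclideanLin.IsSymmetric := by
  rw [Matrix.isSymmetric_toEuclideanLin_iff, Matrix.IsHermitian,
    Matrix.conjTranspose_eq_transpose_of_trivial]
  exact hW.consMatrix_transpose

/-- The constraint `A x = 0` says that all blocks of `x` agree. -/
theorem IsMixingMatrix.consMatrix_eq_zero_iff (hW : IsMixingMatrix G W)
    (x : EuclideanSpace ℝ (Fin n × Fin d)) :
    (consMatrix d W).toEuclideanLin x = 0 ↔ ∃ z, ∀ i, block x i = z := by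
  constructor
  · intro h
    have h1 : ∀ l, ∃ c : ℝ, (fun j => x (j, l)) = fun _ => c := fun l => by
      refine (hW.nullSpace _).1 ?_
      funext i
      rw [← consMatrix_toEuclideanLin_apply, h]
      rfl
    choose c hc using h1
    exact ⟨WithLp.toLp 2 c, fun i => by ext l; exact congrFun (hc l) i⟩
  · rintro ⟨z, hz⟩
    ext ⟨i, l⟩
    rw [consMatrix_toEuclideanLin_apply]
    have : (fun j => x (j, l)) = fun _ => z l := by
      funext j
      rw [← hz j]; rfl
    rw [(hW.nullSpace _).2 ⟨z l, this⟩]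
    rfl

/-- The column space consists of the vectors whose blocks sum to zero. -/
theorem IsMixingMatrix.mem_range_iff (hW : IsMixingMatrix G W)
    (y : EuclideanSpace ℝ (Fin n × Fin d)) :
    y ∈ LinearMap.range (consMatrix d W).toEuclideanLin ↔ ∑ i, block y i = 0 := by
  have key : y ∈ LinearMap.range (consMatrix d W).toEuclideanLin ↔
      ∀ z, inner ℝ z (∑ i, block y i) = 0 := by
    rw [← Submodule.orthogonal_orthogonal (LinearMap.range (consMatrix d W).toEuclideanLin),
      hW.isSymmetric.orthogonal_range, Submodule.mem_orthogonal]
    constructor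
    · intro h z
      have := h (stack fun _ => z) (by
        rw [LinearMap.mem_ker, hW.consMatrix_eq_zero_iff]
        exact ⟨z, fun i => rfl⟩)
      rw [inner_eq_sum_block] at this
      rw [inner_sum]
      exact this
    · intro h u hu
      rw [LinearMap.mem_ker, hW.consMatrix_eq_zero_iff] at hu
      obtain ⟨z, hz⟩ := hu
      rw [inner_eq_sum_block, ← h z, inner_sum]
      simp only [hz]
  rw [key]
  constructor
  · intro h
    exact inner_self_eq_zero.1 (h _)
  · intro h z
    rw [h, inner_zero_right]

end Blocks

/-! ### Spectral bounds for the constraint matrix -/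

theorem Program.norm_sq_le_sigmaMax {m k : Type} [Fintype m] [Fintype k] [DecidableEq k]
    (P : Program m k) (v : EuclideanSpace ℝ k) :
    ‖P.A.toEuclideanLin v‖ ^ 2 ≤ P.sigmaMax * ‖v‖ ^ 2 := by
  classical
  rcases eq_or_ne v 0 with rfl | hv
  · simp
  have : Nontrivial (EuclideanSpace ℝ k) := ⟨v, 0, hv⟩
  set T := (P.A.transpose * P.A).toEuclideanLin with hT
  have hsymm : T.IsSymmetric := by
    rw [hT, Matrix.isSymmetric_toEuclideanLin_iff]
    simpa [Matrix.conjTranspose_eq_transpose_of_trivial] using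
      Matrix.isHermitian_conjTranspose_mul_self P.A
  have hin : ∀ u, inner ℝ (T u) u = ‖P.A.toEuclideanLin u‖ ^ 2 := by
    intro u
    have hTu : T u = LinearMap.adjoint P.A.toEuclideanLin (P.A.toEuclideanLin u) := by
      rw [← Matrix.toEuclideanLin_conjTranspose_eq_adjoint,
        Matrix.conjTranspose_eq_transpose_of_trivial]
      ext i
      simp [hT, Matrix.mulVec_mulVec, Matrix.toLpLin_apply]
    rw [hTu, LinearMap.adjoint_inner_left, real_inner_self_eq_norm_sq]
  have hev := hsymm.hasEigenvalue_iSup_of_finiteDimensional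
  have hbdd : BddAbove (range fun x : { x : EuclideanSpace ℝ k // x ≠ 0 } =>
      RCLike.re (inner ℝ (T x) (x : EuclideanSpace ℝ k)) / ‖(x : EuclideanSpace ℝ k)‖ ^ 2) := by
    refine ⟨‖T.toContinuousLinearMap‖, ?_⟩
    rintro _ ⟨⟨x, hx⟩, rfl⟩
    have h0 : 0 < ‖x‖ := norm_pos_iff.2 hx
    rw [div_le_iff₀ (by positivity)]
    calc RCLike.re (inner ℝ (T x) x) ≤ ‖T x‖ * ‖x‖ := re_inner_le_norm _ _
      _ ≤ ‖T.toContinuousLinearMap‖ * ‖x‖ * ‖x‖ := by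
        gcongr
        exact T.toContinuousLinearMap.le_opNorm x
      _ = _ := by ring
  have h1 := le_ciSup hbdd ⟨v, hv⟩
  have hspec : spectrum ℝ T = spectrum ℝ (P.A.transpose * P.A) := Matrix.spectrum_toLpLin 2
  have h2 : (⨆ x : { x : EuclideanSpace ℝ k // x ≠ 0 },
      RCLike.re (inner ℝ (T x) (x : EuclideanSpace ℝ k)) / ‖(x : EuclideanSpace ℝ k)‖ ^ 2) ≤
      P.sigmaMax := by
    refine le_csSup ?_ ?_
    · rw [← hspec]
      exact (Module.End.finite_spectrum T).bddAbove
    · rw [← hspec]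
      exact hev.mem_spectrum
  have h3 := h1.trans h2
  have h0 : 0 < ‖v‖ := norm_pos_iff.2 hv
  rw [div_le_iff₀ (by positivity)] at h3
  rw [← hin]
  exact h3

/-- The kernel of a symmetric map is orthogonal to its range, so the map is injective, hence bounded
below, on its range. -/
theorem exists_norm_le_mul_norm_of_isSymmetric {E : Type*} [NormedAddCommGroup E]
    [InnerProductSpace ℝ E] [FiniteDimensional ℝ E] {T : E →ₗ[ℝ] E} (hT : T.IsSymmetric) :
    ∃ c : ℝ, 0 < c ∧ ∀ v ∈ LinearMap.range T, ‖v‖ ≤ c * ‖T v‖ := by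
  have hker : LinearMap.ker (T.domRestrict (LinearMap.range T)) = ⊥ := by
    rw [LinearMap.ker_eq_bot']
    rintro ⟨v, hv⟩ h
    have h1 : v ∈ (LinearMap.range T)ᗮ := by
      rw [hT.orthogonal_range]
      exact h
    have := Submodule.inner_right_of_mem_orthogonal hv h1
    exact Subtype.ext (inner_self_eq_zero.1 this)
  obtain ⟨K, hK0, hK⟩ := LinearMap.exists_antilipschitzWith _ hker
  refine ⟨K, hK0, fun v hv => ?_⟩
  simpa [dist_eq_norm] using hK.le_mul_dist ⟨v, hv⟩ 0

/-! ### The explicit dual function of the distributed geometric median problem -/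

section Block

variable {E : Type*} [NormedAddCommGroup E] [InnerProductSpace ℝ E]

theorem neg_inner_sub_norm_le {D : ℝ} {a u : E} (hu : ‖u‖ ≤ D) :
    -(inner ℝ a u) - ‖u‖ ≤ D * max (‖a‖ - 1) 0 := by
  have h1 := neg_le_of_abs_le (abs_real_inner_le_norm a u)
  have h2 : (‖a‖ - 1) * ‖u‖ ≤ max (‖a‖ - 1) 0 * ‖u‖ := by
    gcongr
    exact le_max_left _ _
  have h3 : max (‖a‖ - 1) 0 * ‖u‖ ≤ max (‖a‖ - 1) 0 * D := by gcongr
  linarith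

theorem exists_neg_inner_sub_norm_eq {D : ℝ} (hD : 0 ≤ D) (a : E) :
    ∃ u : E, ‖u‖ ≤ D ∧ -(inner ℝ a u) - ‖u‖ = D * max (‖a‖ - 1) 0 := by
  rcases le_or_gt ‖a‖ 1 with h | h
  · refine ⟨0, by simpa using hD, ?_⟩
    rw [max_eq_right (by linarith)]
    simp
  · have ha : 0 < ‖a‖ := by linarith
    have hn : ‖(-(D / ‖a‖)) • a‖ = D := by
      rw [norm_smul, norm_neg, Real.norm_eq_abs, abs_of_nonneg (by positivity)]
      field_simp
    refine ⟨(-(D / ‖a‖)) • a, hn.le, ?_⟩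
    rw [hn, max_eq_left (by linarith), inner_smul_right, real_inner_self_eq_norm_sq]
    field_simp

end Block

section Median

variable {n d : ℕ} {p : Fin n → EuclideanSpace ℝ (Fin d)} {W : Matrix (Fin n) (Fin n) ℝ} {D : ℝ}
  {G : SimpleGraph (Fin n)}

theorem convexOn_norm_block_sub (p : Fin n → EuclideanSpace ℝ (Fin d)) (i : Fin n) :
    ConvexOn ℝ univ fun x : EuclideanSpace ℝ (Fin n × Fin d) => ‖block x i - p i‖ := by
  refine ⟨convex_univ, fun x _ y _ a b ha hb hab => ?_⟩
  have e : block (a • x + b • y) i - p i = a • (block x i - p i) + b • (block y i - p i) := by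
    have : p i = a • p i + b • p i := by rw [← add_smul, hab, one_smul]
    rw [block_add, block_smul, block_smul]
    nth_rewrite 1 [this]
    module
  change ‖block (a • x + b • y) i - p i‖ ≤ a * ‖block x i - p i‖ + b * ‖block y i - p i‖
  rw [e]
  refine (norm_add_le _ _).trans ?_
  rw [norm_smul, norm_smul, Real.norm_of_nonneg ha, Real.norm_of_nonneg hb]

theorem isConvexProgram_medianProgram (hD : 0 ≤ D) :
    (medianProgram p W D).IsConvexProgram where
  compact := by
    refine Metric.isCompact_of_isClosed_isBounded ?_ ?_
    · have : (medianProgram p W D).X = ⋂ i, {x | ‖block x i - p i‖ ≤ D} := by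
        ext x; simp [medianProgram]
      rw [this]
      refine isClosed_iInter fun i => isClosed_le ?_ continuous_const
      exact ((continuous_block i).sub continuous_const).norm
    · refine (Metric.isBounded_iff_subset_closedBall (stack p)).2 ⟨√(n * D ^ 2), fun x hx => ?_⟩
      rw [mem_closedBall_iff_norm]
      refine Real.le_sqrt_of_sq_le ?_
      rw [norm_sq_eq_sum_block]
      calc ∑ i, ‖block (x - stack p) i‖ ^ 2 ≤ ∑ _i : Fin n, D ^ 2 := by
            refine Finset.sum_le_sum fun i _ => ?_
            have := hx i
            rw [block_sub, block_stack]
            gcongr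
        _ = n * D ^ 2 := by simp
  nonempty := ⟨stack p, fun i => by rw [block_stack, sub_self, norm_zero]; exact hD⟩
  continuous := by
    change Continuous fun x => ∑ i, ‖block x i - p i‖
    exact continuous_finsetSum _ fun i _ => ((continuous_block i).sub continuous_const).norm
  convex := by
    constructor
    · have : (medianProgram p W D).X = ⋂ i, {x | ‖block x i - p i‖ ≤ D} := by
        ext x; simp [medianProgram]
      rw [this]
      refine convex_iInter fun i => ?_
      simpa using (convexOn_norm_block_sub p i).convex_le D
    · intro x _ y _ a b ha hb hab
      simp only [medianProgram, smul_eq_mul, Finset.mul_sum, ← Finset.sum_add_distrib]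
      exact Finset.sum_le_sum fun i _ =>
        (convexOn_norm_block_sub p i).2 (mem_univ x) (mem_univ y) ha hb hab

theorem medianProgram_residual (x : EuclideanSpace ℝ (Fin n × Fin d)) :
    (medianProgram p W D).residual x = (consMatrix d W).toEuclideanLin x := by
  simp [Program.residual, medianProgram]

theorem dualObjective_medianProgram (hW : IsMixingMatrix G W)
    (lam x : EuclideanSpace ℝ (Fin n × Fin d)) :
    (medianProgram p W D).dualObjective lam x =
      -(inner ℝ ((consMatrix d W).toEuclideanLin lam) (stack p)) +
        ∑ i, (-(inner ℝ (block ((consMatrix d W).toEuclideanLin lam) i) (block x i - p i)) -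
          ‖block x i - p i‖) := by
  rw [Program.dualObjective, medianProgram_residual, ← hW.isSymmetric, inner_eq_sum_block,
    inner_eq_sum_block]
  simp only [medianProgram, block_stack, inner_sub_right, Finset.sum_sub_distrib,
    Finset.sum_neg_distrib]
  ring

/-- The Lagrangian separates over the blocks, and each block is maximized over its ball. -/
theorem dual_medianProgram (hW : IsMixingMatrix G W) (hD : 0 ≤ D)
    (lam : EuclideanSpace ℝ (Fin n × Fin d)) :
    (medianProgram p W D).dual lam =
      -(inner ℝ ((consMatrix d W).toEuclideanLin lam) (stack p)) +
        D * ∑ i, max (‖block ((consMatrix d W).toEuclideanLin lam) i‖ - 1) 0 := by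
  refine ((isConvexProgram_medianProgram hD).isGreatest_dual lam).unique ⟨?_, ?_⟩
  · choose u hu hu' using fun i => exists_neg_inner_sub_norm_eq hD
      (block ((consMatrix d W).toEuclideanLin lam) i)
    have hb : ∀ i, block (stack fun i => p i + u i) i - p i = u i := fun i => by
      rw [block_stack]; abel
    refine ⟨stack fun i => p i + u i, fun i => ?_, ?_⟩
    · rw [hb]; exact hu i
    · rw [dualObjective_medianProgram hW, Finset.mul_sum]
      simp only [hb, hu']
  · rintro _ ⟨x, hx, rfl⟩
    rw [dualObjective_medianProgram hW, Finset.mul_sum]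
    gcongr with i
    exact neg_inner_sub_norm_le (hx i)

/-- Along a ray of multipliers whose image under the constraint matrix has one block `t e`, one
block `-t e`, and zeros elsewhere, the dual has a kink at `t = 1`. -/
theorem exists_not_differentiableAt_dual (hW : IsMixingMatrix G W) (hD : 0 < D) {i j : Fin n}
    (hij : i ≠ j) {e : EuclideanSpace ℝ (Fin d)} (he : ‖e‖ = 1) :
    ∃ lam, ¬ DifferentiableAt ℝ (medianProgram p W D).dual lam := by
  set v : Fin n → EuclideanSpace ℝ (Fin d) :=
    fun l => (if l = i then e else 0) - (if l = j then e else 0) with hv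
  obtain ⟨lam, hlam⟩ : stack v ∈ LinearMap.range (consMatrix d W).toEuclideanLin := by
    rw [hW.mem_range_iff]
    simp only [block_stack, hv, Finset.sum_sub_distrib, Finset.sum_ite_eq', Finset.mem_univ,
      if_true, sub_self]
  refine ⟨lam, fun hdiff => not_differentiableAt_abs_zero ?_⟩
  have hF : ∀ s : ℝ, -1 < s → |s| = D⁻¹ * ((medianProgram p W D).dual ((1 + s) • lam) +
      (1 + s) * inner ℝ (stack v) (stack p)) - s := by
    intro s hs
    rw [dual_medianProgram hW hD.le, map_smul, hlam, inner_smul_left]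
    have hblk : ∀ l, max (‖block ((1 + s) • stack v) l‖ - 1) 0 =
        (if l = i then max s 0 else 0) + (if l = j then max s 0 else 0) := by
      intro l
      rw [block_smul, block_stack, norm_smul, Real.norm_of_nonneg (by linarith)]
      by_cases h1 : l = i
      · have h2 : l ≠ j := fun h => hij (h1.symm.trans h)
        simp [hv, h1, hij, he]
      · by_cases h2 : l = j
        · simp [hv, h2, hij.symm, he]
        · simp [hv, h1, h2]
    simp only [hblk, Finset.sum_add_distrib, Finset.sum_ite_eq', Finset.mem_univ, if_true,
      conj_trivial]
    have habs : |s| = 2 * max s 0 - s := by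
      rcases le_total 0 s with h | h
      · rw [abs_of_nonneg h, max_eq_left h]; ring
      · rw [abs_of_nonpos h, max_eq_right h]; ring
    rw [habs]
    field_simp
    ring
  have hline : DifferentiableAt ℝ (fun s : ℝ => (medianProgram p W D).dual ((1 + s) • lam)) 0 := by
    refine DifferentiableAt.comp (g := (medianProgram p W D).dual)
      (f := fun s : ℝ => (1 + s) • lam) 0 ?_ (by fun_prop)
    simpa using hdiff
  have : DifferentiableAt ℝ (fun s : ℝ => D⁻¹ * ((medianProgram p W D).dual ((1 + s) • lam) +
      (1 + s) * inner ℝ (stack v) (stack p)) - s) 0 := by fun_prop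
  refine this.congr_of_eventuallyEq ?_
  filter_upwards [Ioi_mem_nhds (show (-1 : ℝ) < 0 by norm_num)] with s hs using hF s hs

end Median

/-! ### First-order optimality of a geometric median -/

section Certificate

variable {E : Type*} [NormedAddCommGroup E] [InnerProductSpace ℝ E]

theorem norm_add_smul_le {u : E} (hu : u ≠ 0) (v : E) (t : ℝ) :
    ‖u + t • v‖ ≤ ‖u‖ + t * (‖u‖⁻¹ * inner ℝ u v) + t ^ 2 * (‖v‖ ^ 2 / (2 * ‖u‖)) := by
  have h0 : 0 < ‖u‖ := norm_pos_iff.2 hu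
  have h1 : ‖u + t • v‖ ^ 2 = ‖u‖ ^ 2 + 2 * t * inner ℝ u v + t ^ 2 * ‖v‖ ^ 2 := by
    rw [norm_add_sq_real, inner_smul_right, norm_smul, mul_pow, Real.norm_eq_abs, sq_abs]
    ring
  have h2 : 2 * ‖u‖ * ‖u + t • v‖ ≤ ‖u‖ ^ 2 + ‖u + t • v‖ ^ 2 := two_mul_le_add_sq _ _
  rw [h1] at h2
  have h3 : ‖u‖ + t * (‖u‖⁻¹ * inner ℝ u v) + t ^ 2 * (‖v‖ ^ 2 / (2 * ‖u‖)) =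
      (2 * ‖u‖ ^ 2 + 2 * t * inner ℝ u v + t ^ 2 * ‖v‖ ^ 2) / (2 * ‖u‖) := by
    field_simp
  rw [h3, le_div_iff₀ (by positivity)]
  linarith

/-- A geometric median exists. -/
theorem exists_geometric_median [FiniteDimensional ℝ E] {ι : Type*} [Fintype ι] [Nonempty ι]
    (p : ι → E) : ∃ z, ∀ z', ∑ i, ‖z - p i‖ ≤ ∑ i, ‖z' - p i‖ := by
  have hc : Continuous fun z : E => ∑ i, ‖z - p i‖ := by fun_prop
  have : ProperSpace E := FiniteDimensional.proper ℝ E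
  obtain ⟨i₀⟩ := ‹Nonempty ι›
  refine hc.exists_forall_le' (p i₀) ?_
  have hlim : Filter.Tendsto (fun z : E => ‖z - p i₀‖) (Filter.cocompact E) Filter.atTop := by
    simpa [dist_eq_norm] using tendsto_dist_right_cocompact_atTop (p i₀)
  filter_upwards [hlim.eventually_ge_atTop (∑ i, ‖p i₀ - p i‖)] with z hz
  exact hz.trans (Finset.single_le_sum (f := fun i => ‖z - p i‖) (fun i _ => norm_nonneg _)
    (Finset.mem_univ i₀))

/-- The directional derivatives of the distance sum at a geometric median are nonnegative. -/
theorem geometric_median_directional {ι : Type*} [Fintype ι] [DecidableEq E] (p : ι → E)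
    {z : E} (hz : ∀ z', ∑ i, ‖z - p i‖ ≤ ∑ i, ‖z' - p i‖) (v : E) :
    0 ≤ ∑ i, ‖z - p i‖⁻¹ * inner ℝ (z - p i) v + ∑ i, (if z = p i then ‖v‖ else 0) := by
  set a := ∑ i, ‖z - p i‖⁻¹ * inner ℝ (z - p i) v + ∑ i, (if z = p i then ‖v‖ else 0) with ha
  set b := ∑ i, ‖v‖ ^ 2 / (2 * ‖z - p i‖)
  have key : ∀ t ∈ Ioi (0 : ℝ), 0 ≤ a + t * b := by
    intro t ht
    rw [mem_Ioi] at ht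
    have h1 : ∀ i, ‖z + t • v - p i‖ ≤ ‖z - p i‖ + t * (‖z - p i‖⁻¹ * inner ℝ (z - p i) v +
        (if z = p i then ‖v‖ else 0)) + t ^ 2 * (‖v‖ ^ 2 / (2 * ‖z - p i‖)) := by
      intro i
      have e : z + t • v - p i = (z - p i) + t • v := by abel
      rw [e]
      by_cases h : z = p i
      · simp [h, norm_smul, abs_of_pos ht]
      · simpa [h] using norm_add_smul_le (sub_ne_zero.2 h) v t
    have h2 := (hz (z + t • v)).trans (Finset.sum_le_sum fun i _ => h1 i)
    rw [Finset.sum_add_distrib, Finset.sum_add_distrib, ← Finset.mul_sum, ← Finset.mul_sum,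
      Finset.sum_add_distrib, ← ha] at h2
    have h3 : 0 ≤ t * (a + t * b) := by linarith
    exact nonneg_of_mul_nonneg_right h3 ht
  have hlim : Filter.Tendsto (fun t : ℝ => a + t * b) (nhdsWithin 0 (Ioi 0))
      (nhds (a + 0 * b)) :=
    (Continuous.tendsto (by fun_prop) 0).mono_left nhdsWithin_le_nhds
  have := ge_of_tendsto hlim (Filter.mem_of_superset self_mem_nhdsWithin key)
  simpa using this

/-- The point `z` together with negative subgradients `y i` of `‖·‖` at `z - p i` that sum to
zero: this certifies that `z` is a geometric median of `p`. -/
structure MedianCertificate {ι : Type*} [Fintype ι] (p : ι → E) (z : E) (y : ι → E) : Prop where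
  sum_eq_zero : ∑ i, y i = 0
  norm_le_one : ∀ i, ‖y i‖ ≤ 1
  inner_eq : ∀ i, inner ℝ (y i) (z - p i) = -‖z - p i‖

/-- At a geometric median `z ≠ p i` the subgradients are forced; if `z = p k`, then `y k` is minus
the sum of the others, which has norm at most `1` by first-order optimality. -/
theorem exists_medianCertificate [FiniteDimensional ℝ E] {ι : Type*} [Fintype ι]
    [Nonempty ι] {p : ι → E} (hp : Function.Injective p) :
    ∃ z y, MedianCertificate p z y ∧ ∀ i, ‖z - p i‖ ≤ ∑ j, ‖p i - p j‖ := by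
  classical
  obtain ⟨z, hz⟩ := exists_geometric_median p
  set w : E := ∑ i, ‖z - p i‖⁻¹ • (z - p i) with hw
  have hdir := geometric_median_directional p hz (-w)
  have hinn : ∑ i, ‖z - p i‖⁻¹ * inner ℝ (z - p i) (-w) = -‖w‖ ^ 2 := by
    simp only [inner_neg_right, mul_neg, Finset.sum_neg_distrib]
    rw [← real_inner_self_eq_norm_sq]
    nth_rewrite 2 [hw]
    rw [sum_inner]
    simp only [inner_smul_left, conj_trivial]
  rw [hinn, norm_neg] at hdir
  have hbound : ∀ i, ‖z - p i‖ ≤ ∑ j, ‖p i - p j‖ := fun i =>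
    (Finset.single_le_sum (f := fun i => ‖z - p i‖) (fun i _ => norm_nonneg _)
      (Finset.mem_univ i)).trans (hz (p i))
  have hunit : ∀ i, z ≠ p i → ‖‖z - p i‖⁻¹ • (z - p i)‖ = 1 := fun i h => by
    have h0 : ‖z - p i‖ ≠ 0 := norm_ne_zero_iff.2 (sub_ne_zero.2 h)
    rw [norm_smul, norm_inv, norm_norm, inv_mul_cancel₀ h0]
  have hval : ∀ i, inner ℝ (-(‖z - p i‖⁻¹ • (z - p i))) (z - p i) = -‖z - p i‖ := fun i => by
    rcases eq_or_ne (z - p i) 0 with h | h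
    · simp [h]
    · have h0 : ‖z - p i‖ ≠ 0 := norm_ne_zero_iff.2 h
      rw [inner_neg_left, inner_smul_left, real_inner_self_eq_norm_sq, conj_trivial]
      field_simp
  by_cases hk : ∃ k, z = p k
  · obtain ⟨k, hk⟩ := hk
    have hiff : ∀ i, z = p i ↔ i = k := fun i => by rw [hk, hp.eq_iff, eq_comm]
    have hw1 : ‖w‖ ≤ 1 := by
      simp only [hiff, Finset.sum_ite_eq', Finset.mem_univ, if_true] at hdir
      by_contra! h
      nlinarith
    refine ⟨z, fun i => -(‖z - p i‖⁻¹ • (z - p i)) + if i = k then w else 0,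
      ⟨?_, fun i => ?_, fun i => ?_⟩, hbound⟩
    · rw [Finset.sum_add_distrib, Finset.sum_neg_distrib, ← hw]
      simp
    · by_cases h : i = k
      · have h' : z - p i = 0 := sub_eq_zero.2 ((hiff i).2 h)
        rw [h', smul_zero, neg_zero, zero_add, if_pos h]
        exact hw1
      · rw [if_neg h, add_zero, norm_neg]
        exact (hunit i fun h' => h ((hiff i).1 h')).le
    · by_cases h : i = k
      · have h' : z - p i = 0 := sub_eq_zero.2 ((hiff i).2 h)
        rw [h']; simp
      · rw [if_neg h, add_zero, hval]
  · push Not at hk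
    have hw0 : w = 0 := by
      simp only [hk, if_false, Finset.sum_const_zero, add_zero] at hdir
      have : ‖w‖ ^ 2 = 0 := le_antisymm (by linarith) (sq_nonneg _)
      simpa using this
    refine ⟨z, fun i => -(‖z - p i‖⁻¹ • (z - p i)), ⟨?_, fun i => ?_, hval⟩, hbound⟩
    · rw [Finset.sum_neg_distrib, ← hw, hw0, neg_zero]
    · rw [norm_neg]
      exact (hunit i (hk i)).le

end Certificate

/-! ### Quadratic growth of the dual of the median problem -/

section Growth

variable {E : Type*} [NormedAddCommGroup E] [InnerProductSpace ℝ E]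

/-- The contribution of one block to the dual gap, where `u` is the block `z - p i` of the median
and `a` the block of the multiplier image. -/
noncomputable def blockGap (D : ℝ) (a u : E) : ℝ :=
  inner ℝ a u + ‖u‖ + D * max (‖a‖ - 1) 0

theorem blockGap_nonneg {D : ℝ} {a u : E} (hu : ‖u‖ ≤ D) : 0 ≤ blockGap D a u := by
  have := neg_inner_sub_norm_le (a := a) hu
  rw [blockGap]
  linarith

/-- If `b = -u / ‖u‖`, then `⟨a, u⟩ + ‖u‖ = (‖u‖ / 2) (‖a - b‖² + 1 - ‖a‖²)`, so the gap controls
`‖a - b‖²` up to the excess of `‖a‖` over `1`. The excess itself is controlled by the gap because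
`‖u‖` is bounded away from `D`. -/
theorem norm_sub_sq_le_blockGap {D δ : ℝ} {a b u : E} (hD : 0 < D) (hu0 : u ≠ 0)
    (hu : ‖u‖ ≤ D / 2) (hb : ‖b‖ ≤ 1) (hbu : inner ℝ b u = -‖u‖) (hδ : blockGap D a u ≤ δ) :
    ‖a - b‖ ^ 2 ≤ 2 / ‖u‖ * (2 + δ / D) * blockGap D a u := by
  have h0 : 0 < ‖u‖ := norm_pos_iff.2 hu0
  have hu' : ‖u‖ • b = -u := by
    have h1 : ‖‖u‖ • b + u‖ ^ 2 ≤ 0 := by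
      rw [norm_add_sq_real, inner_smul_left, hbu, norm_smul, norm_norm, conj_trivial, mul_pow]
      have : ‖b‖ ^ 2 ≤ 1 := pow_le_one₀ (norm_nonneg _) hb
      nlinarith [sq_nonneg ‖u‖]
    have h2 : ‖u‖ • b + u = 0 :=
      norm_eq_zero.1 (pow_eq_zero_iff two_ne_zero |>.1 (le_antisymm h1 (sq_nonneg _)))
    exact eq_neg_of_add_eq_zero_left h2
  have hab : ‖u‖ * inner ℝ a b = -(inner ℝ a u) := by
    rw [← inner_smul_right, hu', inner_neg_right]
  have hg0 : 0 ≤ blockGap D a u := blockGap_nonneg (by linarith)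
  set g := blockGap D a u with hg
  set s := max (‖a‖ - 1) 0 with hs
  have hs0 : 0 ≤ s := le_max_right _ _
  have hs1 : ‖a‖ ≤ 1 + s := by linarith [le_max_left (‖a‖ - 1) 0]
  have hgs : g = inner ℝ a u + ‖u‖ + D * s := rfl
  have hsg : s * D ≤ 2 * g := by
    have h1 := neg_le_of_abs_le (abs_real_inner_le_norm a u)
    have h2 : ‖a‖ * ‖u‖ ≤ (1 + s) * ‖u‖ := by gcongr
    have h3 : s * ‖u‖ ≤ s * (D / 2) := by gcongr
    linarith
  have hb2 : ‖b‖ ^ 2 ≤ 1 := pow_le_one₀ (norm_nonneg _) hb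
  have ha2 : ‖a‖ ^ 2 ≤ (1 + s) ^ 2 := by gcongr
  have hmain : ‖u‖ * ‖a - b‖ ^ 2 ≤ 2 * (2 + δ / D) * g := by
    have e : ‖u‖ * ‖a - b‖ ^ 2 = ‖u‖ * (‖a‖ ^ 2 + ‖b‖ ^ 2) + 2 * inner ℝ a u := by
      rw [norm_sub_sq_real]; linarith
    have h1 : ‖u‖ * (‖a‖ ^ 2 + ‖b‖ ^ 2) ≤ ‖u‖ * ((1 + s) ^ 2 + 1) := by gcongr
    have h2 : ‖u‖ * (2 * s + s ^ 2) ≤ D / 2 * (2 * s + s ^ 2) := by gcongr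
    have h3 : s ≤ 2 * δ / D := by rw [le_div_iff₀ hD]; linarith
    have h4 : D * s * s ≤ 2 * g * (2 * δ / D) := by
      calc D * s * s = (s * D) * s := by ring
        _ ≤ 2 * g * (2 * δ / D) := by gcongr
    have e2 : 2 * g * (2 * δ / D) = 4 * (δ / D) * g := by ring
    have hDs : 0 ≤ D * s := by positivity
    have : ‖u‖ * ((1 + s) ^ 2 + 1) = 2 * ‖u‖ + ‖u‖ * (2 * s + s ^ 2) := by ring
    linarith
  have e : 2 / ‖u‖ * (2 + δ / D) * g = 2 * (2 + δ / D) * g / ‖u‖ := by ring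
  rw [e, le_div_iff₀ h0, mul_comm]
  exact hmain

/-- The bound for a block `k` with `z = p k`, which the block's own gap does not control, comes
from the blocks summing to zero. -/
theorem MedianCertificate.exists_growth {ι : Type*} [Fintype ι] {p : ι → E}
    (hp : Function.Injective p) {z : E} {y : ι → E} (hy : MedianCertificate p z y)
    {D δ : ℝ} (hD : 0 < D) (hδ : 0 ≤ δ) (hz : ∀ i, ‖z - p i‖ ≤ D / 2) :
    ∃ κ : ℝ, 0 ≤ κ ∧ ∀ a : ι → E, ∑ i, a i = 0 → ∑ i, blockGap D (a i) (z - p i) ≤ δ →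
      ∑ i, ‖a i - y i‖ ^ 2 ≤ κ * ∑ i, blockGap D (a i) (z - p i) := by
  classical
  set κ := ∑ i, 2 / ‖z - p i‖ * (2 + δ / D) with hκ
  have hterm : ∀ i, 0 ≤ 2 / ‖z - p i‖ * (2 + δ / D) := fun i => by positivity
  have hκ0 : 0 ≤ κ := Finset.sum_nonneg fun i _ => hterm i
  set N : ℝ := (Fintype.card ι : ℝ) with hN
  refine ⟨N * ((1 + N) ^ 2 * κ), by positivity, fun a ha hgap => ?_⟩
  set g := ∑ i, blockGap D (a i) (z - p i) with hg
  have hblk : ∀ i, 0 ≤ blockGap D (a i) (z - p i) := fun i =>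
    blockGap_nonneg ((hz i).trans (by linarith))
  have hg0 : 0 ≤ g := Finset.sum_nonneg fun i _ => hblk i
  have hle : ∀ i, blockGap D (a i) (z - p i) ≤ g := fun i =>
    Finset.single_le_sum (fun i _ => hblk i) (Finset.mem_univ i)
  have h1 : ∀ i, z ≠ p i → ‖a i - y i‖ ≤ √(κ * g) := by
    intro i hi
    refine Real.le_sqrt_of_sq_le ?_
    refine (norm_sub_sq_le_blockGap hD (sub_ne_zero.2 hi) (hz i) (hy.norm_le_one i)
      (hy.inner_eq i) ((hle i).trans hgap)).trans ?_
    have := Finset.single_le_sum (f := fun i => 2 / ‖z - p i‖ * (2 + δ / D))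
      (fun i _ => hterm i) (Finset.mem_univ i)
    exact mul_le_mul this (hle i) (hblk i) hκ0
  have hq : 0 ≤ √(κ * g) := Real.sqrt_nonneg _
  have hN0 : 0 ≤ N := Nat.cast_nonneg _
  have h2 : ∀ i, ‖a i - y i‖ ≤ (1 + N) * √(κ * g) := by
    intro i
    by_cases hi : z = p i
    · have hsum : ∑ j, (a j - y j) = 0 := by
        rw [Finset.sum_sub_distrib, ha, hy.sum_eq_zero, sub_self]
      rw [← Finset.add_sum_erase _ _ (Finset.mem_univ i)] at hsum
      rw [eq_neg_of_add_eq_zero_left hsum, norm_neg]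
      refine (norm_sum_le _ _).trans ?_
      calc ∑ j ∈ Finset.univ.erase i, ‖a j - y j‖
          ≤ ∑ _j ∈ Finset.univ.erase i, √(κ * g) := by
            refine Finset.sum_le_sum fun j hj => h1 j fun hzj => ?_
            exact (Finset.mem_erase.1 hj).1 (hp (hzj.symm.trans hi))
        _ ≤ ∑ _j : ι, √(κ * g) :=
            Finset.sum_le_sum_of_subset_of_nonneg (Finset.erase_subset _ _) fun _ _ _ => hq
        _ = N * √(κ * g) := by simp [hN]
        _ ≤ (1 + N) * √(κ * g) := by gcongr; linarith
    · exact (h1 i hi).trans (le_mul_of_one_le_left hq (by linarith))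
  calc ∑ i, ‖a i - y i‖ ^ 2 ≤ ∑ _i : ι, ((1 + N) * √(κ * g)) ^ 2 := by
        refine Finset.sum_le_sum fun i _ => ?_
        have := h2 i
        gcongr
    _ = N * ((1 + N) ^ 2 * κ) * g := by
        rw [mul_pow, Real.sq_sqrt (by positivity)]
        simp only [Finset.sum_const, Finset.card_univ, nsmul_eq_mul]
        ring

variable {n d : ℕ} {p : Fin n → EuclideanSpace ℝ (Fin d)} {W : Matrix (Fin n) (Fin n) ℝ} {D : ℝ}
  {G : SimpleGraph (Fin n)}

/-- The cross terms cancel because the blocks of `A lam` sum to zero, which allows replacing `-p i`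
by `z - p i`. -/
theorem MedianCertificate.dual_gap_eq {z : EuclideanSpace ℝ (Fin d)}
    {y : Fin n → EuclideanSpace ℝ (Fin d)} (hy : MedianCertificate p z y)
    (hW : IsMixingMatrix G W) (hD : 0 ≤ D) {ν : EuclideanSpace ℝ (Fin n × Fin d)}
    (hν : (consMatrix d W).toEuclideanLin ν = stack y) (lam : EuclideanSpace ℝ (Fin n × Fin d)) :
    (medianProgram p W D).dual lam - (medianProgram p W D).dual ν =
      ∑ i, blockGap D (block ((consMatrix d W).toEuclideanLin lam) i) (z - p i) := by
  have hsum := (hW.mem_range_iff _).1 (LinearMap.mem_range_self (consMatrix d W).toEuclideanLin lam)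
  have hconst : ∀ v : Fin n → EuclideanSpace ℝ (Fin d), ∑ i, v i = 0 →
      ∑ i, inner ℝ (v i) (z - p i) = -∑ i, inner ℝ (v i) (p i) := by
    intro v hv
    simp only [inner_sub_right, Finset.sum_sub_distrib]
    rw [← sum_inner, hv, inner_zero_left, zero_sub]
  have hmax : ∀ i, max (‖y i‖ - 1) 0 = 0 := fun i =>
    max_eq_right (sub_nonpos.2 (hy.norm_le_one i))
  rw [dual_medianProgram hW hD, dual_medianProgram hW hD, hν, inner_eq_sum_block,
    inner_eq_sum_block]
  simp only [block_stack, hmax, blockGap, Finset.sum_add_distrib, ← Finset.mul_sum]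
  rw [hconst _ hsum, ← hconst _ hy.sum_eq_zero]
  simp only [hy.inner_eq, Finset.sum_neg_distrib, Finset.sum_const_zero]
  ring

/-- The dual of the median problem grows quadratically on every sublevel set, around the point `ν`
of the column space whose image consists of the subgradients of a median certificate. -/
theorem exists_quadraticDualGrowth (hn : 0 < n) (hp : Function.Injective p)
    (hW : IsMixingMatrix G W) (hD : 0 < D) (hpD : ∀ i j, 2 * (n : ℝ) * ‖p i - p j‖ ≤ D) :
    ∃ ν, ∀ δ : ℝ, 0 ≤ δ → ∃ C₀ : ℝ, 0 ≤ C₀ ∧ (medianProgram p W D).QuadraticDualGrowth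
      (LinearMap.range (consMatrix d W).toEuclideanLin) ν δ C₀ := by
  have : Nonempty (Fin n) := ⟨⟨0, hn⟩⟩
  have hn' : (0 : ℝ) < n := Nat.cast_pos.2 hn
  obtain ⟨z, y, hy, hz⟩ := exists_medianCertificate hp
  have hzD : ∀ i, ‖z - p i‖ ≤ D / 2 := fun i => by
    refine (hz i).trans ?_
    calc ∑ j, ‖p i - p j‖ ≤ ∑ _j : Fin n, D / (2 * n) :=
          Finset.sum_le_sum fun j _ => by
            rw [le_div_iff₀ (by positivity)]; linarith [hpD i j]
      _ = D / 2 := by simp; field_simp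
  set A := (consMatrix d W).toEuclideanLin with hA
  set V := LinearMap.range A
  obtain ⟨lam₀, hlam₀⟩ : stack y ∈ V := (hW.mem_range_iff _).2 hy.sum_eq_zero
  have hproj : ∀ lam, A (V.starProjection lam) = A lam := fun lam => by
    have h1 := V.sub_starProjection_mem_orthogonal lam
    rw [hW.isSymmetric.orthogonal_range, LinearMap.mem_ker, map_sub] at h1
    exact (sub_eq_zero.1 h1).symm
  have hν : A (V.starProjection lam₀) = stack y := (hproj lam₀).trans hlam₀
  obtain ⟨c, hc0, hc⟩ := exists_norm_le_mul_norm_of_isSymmetric (hW.isSymmetric (d := d))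
  refine ⟨V.starProjection lam₀, fun δ hδ => ?_⟩
  obtain ⟨κ, hκ0, hκ⟩ := hy.exists_growth hp hD hδ hzD
  have hgap := hy.dual_gap_eq hW hD.le hν
  refine ⟨c ^ 2 * κ, by positivity, ⟨fun x => ?_, V.starProjection_apply_mem _, fun lam => ?_,
    fun lam hlam => ?_⟩⟩
  · rw [medianProgram_residual]
    exact LinearMap.mem_range_self _ x
  · rw [← sub_nonneg, hgap]
    exact Finset.sum_nonneg fun i _ => blockGap_nonneg ((hzD i).trans (by linarith))
  · rw [hgap] at hlam ⊢
    have h1 := hκ _ ((hW.mem_range_iff _).1 (LinearMap.mem_range_self A lam)) hlam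
    have h2 : ‖A (V.starProjection lam - V.starProjection lam₀)‖ ^ 2 =
        ∑ i, ‖block (A lam) i - y i‖ ^ 2 := by
      rw [map_sub, hproj, hν, norm_sq_eq_sum_block]
      rfl
    have h3 := hc (V.starProjection lam - V.starProjection lam₀)
      (V.sub_mem (V.starProjection_apply_mem _) (V.starProjection_apply_mem _))
    calc ‖V.starProjection lam - V.starProjection lam₀‖ ^ 2
        ≤ (c * ‖A (V.starProjection lam - V.starProjection lam₀)‖) ^ 2 := by gcongr
      _ = c ^ 2 * ∑ i, ‖block (A lam) i - y i‖ ^ 2 := by rw [mul_pow, h2]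
      _ ≤ _ := by rw [mul_assoc]; gcongr

end Growth

end DistMedian

theorem theorem3 (n d : ℕ) (hn : 3 ≤ n) (p : Fin n → EuclideanSpace ℝ (Fin d))
    (hp : Function.Injective p) (hcol : ¬ Collinear ℝ (Set.range p))
    (G : SimpleGraph (Fin n)) (hG : G.Connected)
    (W : Matrix (Fin n) (Fin n) ℝ) (hW : IsMixingMatrix G W) (D : ℝ) (hD : 0 < D) :
    -- the maximum in the dual function is attained, and the dual function is explicit
    (∀ lam : EuclideanSpace ℝ (Fin n × Fin d),
      IsGreatest ((medianProgram p W D).dualObjective lam '' (medianProgram p W D).X)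
        ((medianProgram p W D).dual lam) ∧
      (medianProgram p W D).dual lam =
        -(inner ℝ ((consMatrix d W).transpose.toEuclideanLin lam) (stack p)) +
          D * ∑ i, (‖(colBlock (consMatrix d W) i).transpose.toEuclideanLin lam‖ - 1) *
            (if 1 < ‖(colBlock (consMatrix d W) i).transpose.toEuclideanLin lam‖
              then (1 : ℝ) else 0)) ∧
    -- the dual function is non-smooth
    (∃ lam, ¬ DifferentiableAt ℝ (medianProgram p W D).dual lam) ∧
    ((∀ i j, 2 * (n : ℝ) * ‖p i - p j‖ ≤ D) →
      -- local error bound with parameter 1/2 on every sublevel set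
      (∀ δ : ℝ, 0 < δ → LocalErrorBound (medianProgram p W D).dual (1 / 2) δ) ∧
      -- the optimal multipliers are unique up to the null space of the transposed matrix
      (∃! ν, ∀ lam ∈ minimizers (medianProgram p W D).dual,
        (medianProgram p W D).colProj lam = ν) ∧
      (∃ ν, minimizers (medianProgram p W D).dual =
        {lam | (medianProgram p W D).colProj lam = ν}) ∧
      -- convergence time of the homotopy method
      (∀ R M γ ε0 : ℝ, 0 < R → 0 < M → 0 < γ →
        (∀ x ∈ (medianProgram p W D).X, ∀ y ∈ (medianProgram p W D).X, ‖x - y‖ ≤ R) →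
        (∀ x ∈ (medianProgram p W D).X, |(medianProgram p W D).f x| ≤ M) →
        γ * (medianProgram p W D).sigmaMax ≤ 1 → max (2 * M) 1 ≤ ε0 →
        ∃ c C : ℝ, 0 < c ∧ 0 < C ∧
          ∀ ε : ℝ, 0 < ε → ε ≤ 1 / 2 → ∀ x0 ∈ (medianProgram p W D).X,
            (∀ T : ℕ, c * ε ^ (-(4 / 5) : ℝ) ≤ T →
              (medianProgram p W D).IsApproxSolution C ε
                ((medianProgram p W D).homotopy γ R ε0 x0 T
                  (⌈Real.logb 2 (ε0 / ε)⌉₊ + 1)).x) ∧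
            (((medianProgram p W D).homotopy γ R ε0 x0 ⌈c * ε ^ (-(4 / 5) : ℝ)⌉₊
                (⌈Real.logb 2 (ε0 / ε)⌉₊ + 1)).steps : ℝ) ≤
              C * ε ^ (-(4 / 5) : ℝ) * Real.logb 2 (1 / ε))) := by
  have hP := isConvexProgram_medianProgram (p := p) (W := W) hD.le
  have hi : (⟨0, by omega⟩ : Fin n) ≠ ⟨1, by omega⟩ := by simp
  refine ⟨fun lam => ⟨hP.isGreatest_dual lam, ?_⟩, ?_, fun hpD => ?_⟩
  · rw [dual_medianProgram hW hD.le]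
    simp only [colBlock_transpose_apply, hW.consMatrix_transpose]
    congr 3
    funext i
    split_ifs with h
    · rw [max_eq_left (by linarith), mul_one]
    · rw [max_eq_right (by linarith), mul_zero]
  · have h0 := sub_ne_zero.2 (hp.ne hi)
    refine exists_not_differentiableAt_dual hW hD hi
      (e := ‖p ⟨0, by omega⟩ - p ⟨1, by omega⟩‖⁻¹ • (p ⟨0, by omega⟩ - p ⟨1, by omega⟩)) ?_
    rw [norm_smul, norm_inv, norm_norm]
    exact inv_mul_cancel₀ (norm_ne_zero_iff.2 h0)
  · obtain ⟨ν, hν⟩ := exists_quadraticDualGrowth (by omega) hp hW hD hpD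
    obtain ⟨_, -, hG₀⟩ := hν 0 le_rfl
    have hmin : minimizers (medianProgram p W D).dual =
        {lam | (medianProgram p W D).colProj lam = ν} := hG₀.minimizers_eq le_rfl
    refine ⟨fun δ hδ => ?_, ⟨ν, fun lam hlam => ?_, fun ν' hν' => ?_⟩, ⟨ν, hmin⟩, ?_⟩
    · obtain ⟨C₀, hC₀, hG⟩ := hν δ hδ.le
      exact hG.localErrorBound hP hC₀
    · rw [hmin] at hlam
      exact hlam
    · have hmem : ν ∈ minimizers (medianProgram p W D).dual := hG₀.isMin
      rw [← hν' ν hmem]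
      rw [hmin] at hmem
      exact hmem
    · intro R M γ ε0 hR hM hγ hdiam hf hσ hε0
      obtain ⟨C₀, hC₀, hG⟩ := hν ε0 (zero_le_one.trans ((le_max_right _ _).trans hε0))
      have hfeas : ∃ x ∈ (medianProgram p W D).X, (medianProgram p W D).residual x = 0 := by
        have hn1 : (1 : ℝ) ≤ n := by exact_mod_cast (by omega : 1 ≤ n)
        refine ⟨stack fun _ => p ⟨0, by omega⟩, fun i => ?_, ?_⟩
        · refine le_trans ?_ (hpD ⟨0, by omega⟩ i)
          rw [block_stack]
          exact le_mul_of_one_le_left (norm_nonneg _) (by linarith)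
        · rw [medianProgram_residual, hW.consMatrix_eq_zero_iff]
          exact ⟨p ⟨0, by omega⟩, fun i => rfl⟩
      refine hG.exists_homotopy_rate hP hfeas hC₀ hγ ((le_max_right _ _).trans hε0)
        (fun v => ?_) hR hdiam ?_
      · have h1 := mul_le_mul_of_nonneg_left ((medianProgram p W D).norm_sq_le_sigmaMax v) hγ.le
        have h2 := mul_le_mul_of_nonneg_right hσ (sq_nonneg ‖v‖)
        linarith
      · have h0 : (medianProgram p W D).dual 0 = 0 := by
          rw [dual_medianProgram hW hD.le, map_zero, inner_zero_left]
          have : ∀ i, block (0 : EuclideanSpace ℝ (Fin n × Fin d)) i = 0 := fun i => rfl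
          simp [this]
        obtain ⟨x, hx, hr⟩ := hfeas
        have h1 := hP.dualObjective_le ν hx
        simp only [Program.dualObjective, hr, inner_zero_right] at h1
        have h2 := le_of_abs_le (hf x hx)
        have h3 := (le_max_left _ _).trans hε0
        linarith
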